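/- Let $M$ be a connected smooth Riemannian manifold without boundary, with its Riemannian distance, and let $\Delta^k=\{z\in\mathbb R^{k+1}_{\ge 0} : \sum_i z_i=1\}$ carry the Euclidean metric. Let $C_*(M)$ be the singular chain complex of $M$ with real coefficients. For a singular simplex $\sigma\colon\Delta^k\to M$ let $\operatorname{Lip}(\sigma)\in[0,\infty]$ be its Lipschitz constant, and let $C_*^{\mathrm{Lip}}(M)\subset C_*(M)$ be the subcomplex of chains all of whose simplices have finite Lipschitz constant. Let $C^*_{\mathrm{cs}}(M)\subset \operatorname{Hom}_{\mathbb R}(C_*(M),\mathbb R)$ be the subcomplex of cochains with compact support, i.e. those $f$ for which there is a compact set $K\subset M$ with $f(\sigma)=0$ for all singular simplices $\sigma$ with image in $M\setminus K$. Let $C^*_{\mathrm{cs},\mathrm{Lip}}(M)\subset\operatorname{Hom}_{\mathbb R}(C_*^{\mathrm{Lip}}(M),\mathbb R)$ be the subcomplex of cochains with Lipschitz compact support, i.e. those $f$ such that for every $L>0$ there is a compact set $K\subset M$ with $f(\sigma)=0$ for all singular simplices $\sigma$ with $\operatorname{Lip}(\sigma)<L$ and image in $M\setminus K$. Then the cochain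 map $C^*_{\mathrm{cs}}(M)\to C^*_{\mathrm{cs},\mathrm{Lip}}(M)$ given by restricting cochains from $C_*(M)$ to $C_*^{\mathrm{Lip}}(M)$ induces an isomorphism on cohomology in every degree. -/

import Mathlib

open scoped Manifold ContDiff Bundle NNReal ENNReal

noncomputable section

namespace LipCoho

/-! ### Singular simplices and singular chains with real coefficients -/

/-- The standard simplex `Δ^k = {z ∈ ℝ_{≥0}^{k+1} ; ∑ z_i = 1}`, as a subset (hence a metric
subspace) of the Euclidean space `ℝ^{k+1}`. -/
def stdDelta (k : ℕ) : Set (EuclideanSpace ℝ (Fin (k + 1))) :=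
  {z | (∀ i, 0 ≤ z i) ∧ ∑ i, z i = 1}

/-- The `i`-th face inclusion `Δ^k → Δ^{k+1}`, inserting a zero coordinate at position `i`. -/
def faceIncl (k : ℕ) (i : Fin (k + 2)) (z : stdDelta k) : stdDelta (k + 1) :=
  ⟨WithLp.toLp 2 (i.insertNth (0 : ℝ) (fun j => z.1 j) : Fin (k + 2) → ℝ), by
    constructor
    · intro j
      refine Fin.succAboveCases i ?_ (fun l => ?_) j
      · simp
      · simpa using z.2.1 l
    · simpa [Fin.sum_univ_succAbove _ i] using z.2.2⟩

theorem isometry_faceIncl (k : ℕ) (i : Fin (k + 2)) : Isometry (faceIncl k i) := by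
  refine Isometry.of_dist_eq fun x y => ?_
  rw [Subtype.dist_eq, Subtype.dist_eq, EuclideanSpace.dist_eq, EuclideanSpace.dist_eq,
    Fin.sum_univ_succAbove _ i]
  simp [faceIncl]

theorem faceIncl_faceIncl (k : ℕ) {i j : Fin (k + 2)} (h : i ≤ j) (z : stdDelta k) :
    faceIncl (k + 1) j.succ (faceIncl k i z) = faceIncl (k + 1) i.castSucc (faceIncl k j z) := by
  apply Subtype.ext
  ext l
  simp only [faceIncl]
  refine Fin.succAboveCases j.succ ?_ (fun m => ?_) l
  · have e : j.succ = i.castSucc.succAbove j :=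
      (Fin.succAbove_of_le_castSucc _ _ (Fin.castSucc_le_castSucc_iff.2 h)).symm
    rw [Fin.insertNth_apply_same, e, Fin.insertNth_apply_succAbove, Fin.insertNth_apply_same]
  · rw [Fin.insertNth_apply_succAbove]
    refine Fin.succAboveCases i ?_ (fun p => ?_) m
    · have e : j.succ.succAbove i = i.castSucc :=
        Fin.succAbove_of_castSucc_lt _ _ (Fin.castSucc_lt_succ_iff.2 h)
      rw [e, Fin.insertNth_apply_same, Fin.insertNth_apply_same]
    · have e : j.succ.succAbove (i.succAbove p) = i.castSucc.succAbove (j.succAbove p) := by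
        simp only [Fin.succAbove, Fin.lt_def, Fin.le_def, Fin.ext_iff] at h ⊢
        split_ifs <;> simp_all <;> omega
      rw [e]
      simp only [Fin.insertNth_apply_succAbove]

section Top

variable (X : Type*) [TopologicalSpace X]

/-- `map(Δ^k, X)`: the set of singular `k`-simplices of `X`. -/
abbrev Simplex (k : ℕ) : Type _ := C(stdDelta k, X)

variable {X}

/-- The `i`-th face of a singular simplex. -/
def face {k : ℕ} (i : Fin (k + 2)) (σ : Simplex X (k + 1)) : Simplex X k :=
  σ.comp ⟨faceIncl k i, (isometry_faceIncl k i).continuous⟩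

theorem face_face {k : ℕ} {i j : Fin (k + 2)} (h : i ≤ j) (σ : Simplex X (k + 2)) :
    face i (face j.succ σ) = face j (face i.castSucc σ) := by
  ext z
  exact congrArg σ (faceIncl_faceIncl k h z)

theorem range_face_subset {k : ℕ} (i : Fin (k + 2)) (σ : Simplex X (k + 1)) :
    Set.range (face i σ) ⊆ Set.range σ := by
  rintro _ ⟨z, rfl⟩
  exact ⟨_, rfl⟩

variable (X)

/-- `C_k(X)`: the real singular `k`-chains of `X`, i.e. the real vector space with basis
the singular `k`-simplices. -/
abbrev Chain (k : ℕ) : Type _ := Simplex X k →₀ ℝ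

/-- The singular boundary operator `∂ σ = ∑ i, (-1)^i σ ∘ d_i`. -/
def bdry (k : ℕ) : Chain X (k + 1) →ₗ[ℝ] Chain X k :=
  Finsupp.linearCombination ℝ fun σ =>
    ∑ i : Fin (k + 2), ((-1 : ℝ) ^ (i : ℕ)) • Finsupp.single (face i σ) (1 : ℝ)

variable {X}

theorem bdry_single (k : ℕ) (σ : Simplex X (k + 1)) :
    bdry X k (Finsupp.single σ 1) =
      ∑ i : Fin (k + 2), ((-1 : ℝ) ^ (i : ℕ)) • Finsupp.single (face i σ) (1 : ℝ) := by
  simp [bdry]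

theorem bdry_bdry (k : ℕ) (c : Chain X (k + 2)) : bdry X k (bdry X (k + 1) c) = 0 := by
  suffices h : bdry X k ∘ₗ bdry X (k + 1) = 0 from LinearMap.congr_fun h c
  refine Finsupp.lhom_ext' fun σ => LinearMap.ext_ring ?_
  simp only [LinearMap.comp_apply, Finsupp.lsingle_apply, LinearMap.zero_apply]
  rw [bdry_single, map_sum]
  simp only [map_smul, bdry_single, Finset.smul_sum]
  rw [Finset.sum_comm, ← Finset.sum_product']
  let P := Fin (k + 2) × Fin (k + 3)
  let S : Finset P := {ij : P | (ij.2 : ℕ) ≤ (ij.1 : ℕ)}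
  rw [Finset.univ_product_univ, ← Finset.sum_add_sum_compl S, ← eq_neg_iff_add_eq_zero,
    ← Finset.sum_neg_distrib]
  let φ : ∀ ij : P, ij ∈ S → P := fun ij hij =>
    (Fin.castLT ij.2 (lt_of_le_of_lt (Finset.mem_filter.mp hij).right (Fin.is_lt ij.1)), ij.1.succ)
  apply Finset.sum_bij φ
  · intro ij hij
    simp_rw [S, φ, Finset.compl_filter, Finset.mem_filter_univ, Fin.val_succ,
      Fin.val_castLT] at hij ⊢
    lia
  · rintro ⟨i, j⟩ hij ⟨i', j'⟩ hij' h
    rw [Prod.mk_inj]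
    exact ⟨by simpa [φ] using! congr_arg Prod.snd h,
      by simpa [φ, Fin.castSucc_castLT] using! congr_arg Fin.castSucc (congr_arg Prod.fst h)⟩
  · rintro ⟨i', j'⟩ hij'
    simp_rw [S, Finset.compl_filter, Finset.mem_filter_univ, not_le] at hij'
    refine ⟨(j'.pred <| ?_, Fin.castSucc i'), ?_, ?_⟩
    · rintro rfl
      simp only [Fin.val_zero, not_lt_zero] at hij'
    · simpa [S] using! Nat.le_sub_one_of_lt hij'
    · simp only [φ, Fin.castLT_castSucc, Fin.succ_pred]
  · rintro ⟨i, j⟩ hij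
    have hle : (j : ℕ) ≤ (i : ℕ) := (Finset.mem_filter.mp hij).right
    have hlt : (j : ℕ) < k + 2 := lt_of_le_of_lt hle i.is_lt
    have key := face_face (i := Fin.castLT j hlt) (j := i) hle σ
    rw [Fin.castSucc_castLT] at key
    simp only [φ, smul_smul, Fin.val_succ, Fin.val_castLT, key, ← neg_smul]
    congr 1
    ring

variable (X)

/-- The coboundary `f ↦ f ∘ ∂` on `C^k(X) = Hom_ℝ(C_k(X), ℝ)`. -/
abbrev cobdry (k : ℕ) : Module.Dual ℝ (Chain X k) →ₗ[ℝ] Module.Dual ℝ (Chain X (k + 1)) :=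
  (bdry X k).dualMap

/-- `C_cs^k(X)`: the singular `k`-cochains with compact support, i.e. those that vanish on all
simplices in the complement of some compact subset. -/
def csCochain (k : ℕ) : Submodule ℝ (Module.Dual ℝ (Chain X k)) where
  carrier := {f | ∃ K : Set X, IsCompact K ∧
    ∀ σ : Simplex X k, Set.range σ ⊆ Kᶜ → f (Finsupp.single σ 1) = 0}
  zero_mem' := ⟨∅, isCompact_empty, fun _ _ => rfl⟩
  add_mem' := by
    rintro f g ⟨K, hK, hf⟩ ⟨K', hK', hg⟩
    refine ⟨K ∪ K', hK.union hK', fun σ hσ => ?_⟩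
    rw [Set.compl_union, Set.subset_inter_iff] at hσ
    rw [LinearMap.add_apply, hf σ hσ.1, hg σ hσ.2, add_zero]
  smul_mem' := by
    rintro a f ⟨K, hK, hf⟩
    exact ⟨K, hK, fun σ hσ => by rw [LinearMap.smul_apply, hf σ hσ, smul_zero]⟩

variable {X} in
theorem cobdry_mem_csCochain {k : ℕ} {f : Module.Dual ℝ (Chain X k)} (hf : f ∈ csCochain X k) :
    cobdry X k f ∈ csCochain X (k + 1) := by
  obtain ⟨K, hK, hf⟩ := hf
  refine ⟨K, hK, fun σ hσ => ?_⟩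
  rw [LinearMap.dualMap_apply, bdry_single, map_sum]
  refine Finset.sum_eq_zero fun i _ => ?_
  rw [map_smul, hf _ ((range_face_subset i σ).trans hσ), smul_zero]

/-- The coboundary operator of `C_cs^*(X)`. -/
def csCobdry (k : ℕ) : csCochain X k →ₗ[ℝ] csCochain X (k + 1) :=
  (cobdry X k).restrict fun _ hf => cobdry_mem_csCochain hf

/-- The cochain complex `C_cs^*(X)` of singular cochains with compact support. -/
def csComplex : CochainComplex (ModuleCat ℝ) ℕ :=
  CochainComplex.of (fun k => ModuleCat.of ℝ (csCochain X k))
    (fun k => ModuleCat.ofHom (csCobdry X k)) (fun k => by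
      ext f : 2
      refine Subtype.ext (LinearMap.ext fun c => ?_)
      exact (congrArg f.1 (bdry_bdry k c)).trans (map_zero f.1))

end Top

/-! ### Lipschitz chains and cochains with Lipschitz compact support

Distances are allowed to take the value `∞` here; they are finite on every connected
Riemannian manifold. -/

section Metric

variable {X : Type*} [EMetricSpace X]

/-- `Lip(σ) ∈ [0, ∞]`: the infimum of all Lipschitz constants of the singular simplex `σ`. -/
def lip {k : ℕ} (σ : Simplex X k) : ℝ≥0∞ :=
  ⨅ (C : ℝ≥0) (_ : LipschitzWith C σ), (C : ℝ≥0∞)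

theorem lip_face_le {k : ℕ} (i : Fin (k + 2)) (σ : Simplex X (k + 1)) :
    lip (face i σ) ≤ lip σ := by
  refine le_iInf₂ fun C hC => iInf₂_le C ?_
  simpa using! hC.comp (isometry_faceIncl k i).lipschitz

variable (X)

/-- `C_k^Lip(X) = {c ∈ C_k(X) ; Lip(c) < ∞}`: the chains all of whose (finitely many) simplices
have a finite Lipschitz constant. -/
def lipChain (k : ℕ) : Submodule ℝ (Chain X k) :=
  Finsupp.supported ℝ ℝ {σ : Simplex X k | lip σ < ⊤}

variable {X}

theorem single_mem_lipChain {k : ℕ} {σ : Simplex X k} (hσ : lip σ < ⊤) (a : ℝ) :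
    Finsupp.single σ a ∈ lipChain X k :=
  Finsupp.single_mem_supported ℝ a hσ

/-- A Lipschitz simplex, viewed as a Lipschitz chain. -/
def lipSingle {k : ℕ} (σ : Simplex X k) (hσ : lip σ < ⊤) : lipChain X k :=
  ⟨Finsupp.single σ 1, single_mem_lipChain hσ 1⟩

theorem bdry_mem_lipChain {k : ℕ} {c : Chain X (k + 1)} (hc : c ∈ lipChain X (k + 1)) :
    bdry X k c ∈ lipChain X k := by
  rw [bdry, Finsupp.linearCombination_apply]
  refine Submodule.sum_mem _ fun σ hσ => Submodule.smul_mem _ _ ?_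
  exact Submodule.sum_mem _ fun i _ => Submodule.smul_mem _ _
    (single_mem_lipChain ((lip_face_le i σ).trans_lt (hc hσ)) 1)

variable (X)

/-- The boundary operator of `C_*^Lip(X)`, the restriction of the singular one. -/
def lipBdry (k : ℕ) : lipChain X (k + 1) →ₗ[ℝ] lipChain X k :=
  (bdry X k).restrict fun _ hc => bdry_mem_lipChain hc

variable {X} in
theorem lipBdry_lipSingle {k : ℕ} (σ : Simplex X (k + 1)) (hσ : lip σ < ⊤) :
    lipBdry X k (lipSingle σ hσ) = ∑ i : Fin (k + 2), ((-1 : ℝ) ^ (i : ℕ)) •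
      lipSingle (face i σ) ((lip_face_le i σ).trans_lt hσ) := by
  apply Subtype.ext
  simpa [lipSingle, lipBdry] using bdry_single k σ

/-- The coboundary `f ↦ f ∘ ∂` on `Hom_ℝ(C_k^Lip(X), ℝ)`. -/
abbrev lipCobdry (k : ℕ) :
    Module.Dual ℝ (lipChain X k) →ₗ[ℝ] Module.Dual ℝ (lipChain X (k + 1)) :=
  (lipBdry X k).dualMap

/-- `C_cs,Lip^k(X)`: the cochains `f ∈ Hom_ℝ(C_k^Lip(X), ℝ)` with Lipschitz compact support: for
every `L > 0` there is a compact `K ⊆ X` such that `f(σ) = 0` for all `σ : Δ^k → X` with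
`Lip(σ) < L` and image in `X - K`. -/
def cslipCochain (k : ℕ) : Submodule ℝ (Module.Dual ℝ (lipChain X k)) where
  carrier := {f | ∀ L : ℝ, 0 < L → ∃ K : Set X, IsCompact K ∧
    ∀ (σ : Simplex X k) (hσ : lip σ < ENNReal.ofReal L), Set.range σ ⊆ Kᶜ →
      f (lipSingle σ (hσ.trans ENNReal.ofReal_lt_top)) = 0}
  zero_mem' := fun _ _ => ⟨∅, isCompact_empty, fun _ _ _ => rfl⟩
  add_mem' := by
    intro f g hf hg L hL
    obtain ⟨K, hK, hf⟩ := hf L hL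
    obtain ⟨K', hK', hg⟩ := hg L hL
    refine ⟨K ∪ K', hK.union hK', fun σ hσ h => ?_⟩
    rw [Set.compl_union, Set.subset_inter_iff] at h
    rw [LinearMap.add_apply, hf σ hσ h.1, hg σ hσ h.2, add_zero]
  smul_mem' := by
    intro a f hf L hL
    obtain ⟨K, hK, hf⟩ := hf L hL
    exact ⟨K, hK, fun σ hσ h => by rw [LinearMap.smul_apply, hf σ hσ h, smul_zero]⟩

variable {X} in
theorem lipCobdry_mem_cslipCochain {k : ℕ} {f : Module.Dual ℝ (lipChain X k)}
    (hf : f ∈ cslipCochain X k) : lipCobdry X k f ∈ cslipCochain X (k + 1) := by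
  intro L hL
  obtain ⟨K, hK, hf⟩ := hf L hL
  refine ⟨K, hK, fun σ hσ h => ?_⟩
  rw [LinearMap.dualMap_apply, lipBdry_lipSingle, map_sum]
  refine Finset.sum_eq_zero fun i _ => ?_
  rw [map_smul, hf _ ((lip_face_le i σ).trans_lt hσ) ((range_face_subset i σ).trans h), smul_zero]

/-- The coboundary operator of `C_cs,Lip^*(X)`. -/
def cslipCobdry (k : ℕ) : cslipCochain X k →ₗ[ℝ] cslipCochain X (k + 1) :=
  (lipCobdry X k).restrict fun _ hf => lipCobdry_mem_cslipCochain hf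

/-- The cochain complex `C_cs,Lip^*(X)` of cochains with Lipschitz compact support; its cohomology
is the cohomology with Lipschitz compact supports. -/
def cslipComplex : CochainComplex (ModuleCat ℝ) ℕ :=
  CochainComplex.of (fun k => ModuleCat.of ℝ (cslipCochain X k))
    (fun k => ModuleCat.ofHom (cslipCobdry X k)) (fun k => by
      ext f : 2
      refine Subtype.ext (LinearMap.ext fun c => ?_)
      have h : lipBdry X k (lipBdry X (k + 1) c) = 0 := Subtype.ext (bdry_bdry k c.1)
      exact (congrArg f.1 h).trans (map_zero f.1))

/-- Restriction of compactly supported cochains from `C_k(X)` to `C_k^Lip(X)`. -/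
def restrictCochain (k : ℕ) : csCochain X k →ₗ[ℝ] cslipCochain X k :=
  (lipChain X k).subtype.dualMap.restrict fun f hf => by
    obtain ⟨K, hK, hf⟩ := hf
    exact fun L _ => ⟨K, hK, fun σ _ h => hf σ h⟩

/-- The natural cochain map `C_cs^*(X) ⟶ C_cs,Lip^*(X)` given by restriction. -/
def restriction : csComplex X ⟶ cslipComplex X :=
  CochainComplex.ofHom (fun k => ModuleCat.ofHom (restrictCochain X k)) (fun k => by
    simp only [csComplex, cslipComplex, CochainComplex.of_d]
    ext f : 2
    rfl)

end Metric

end LipCoho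

end

/-! The proof rests on one chain homotopy `H`, built in a finite range of degrees. Put `T = id - ∂H
- H∂` (`deform H`). Every simplex of `T σ` has Lipschitz constant at most a number depending on the
degree alone, even when `σ` is merely continuous. Moreover `H` turns a Lipschitz bound into a
Lipschitz bound, and for every compact `K` there is a compact `K'` such that `H` keeps simplices
outside `K'` away from `K`. Precomposition with `T` then turns Lipschitz compact support into
compact support: all simplices of all `T σ` obey one bound `L`, so the compact set belonging to this
single `L` suffices. It inverts the restriction on cohomology, and precomposition with `H`, which
preserves both support conditions, supplies the homotopies.

`H` combines two homotopies. Adapted barycentric subdivision (`adaptHom`) makes simplices small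
relative to a 1-Lipschitz scale `r` on `X`. The number of subdivisions depends on the simplex and is
unbounded, but the pieces are `ℓ¹`-contractions of the original, so Lipschitz constants grow only by
a factor depending on the dimension (`adaptHom_mem`). Straightening (`straight`) then replaces a
small simplex by iterated cones with apexes at its vertices. One cone turns a bound `B` into `C * (2
+ 2 * B)` (`lip_cone_le`), and 0-simplices have constant 0, so the final bound depends only on `C`
and the degree (`exists_straightControl`).

The geometric input is `LocalCones`: contractions of small balls to their centres with the
distortion of linear contractions. On a Riemannian manifold, a chart corrected by a linear map is
2-Lipschitz in both directions near its base point, so straight lines in the chart give distortion 4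
(`exists_conical_nhd`). This constant is the same at all points; the nonuniformity of `M` is
absorbed by the scale `r` (`nonempty_localCones`). -/

noncomputable section

namespace LipCoho

open Filter Topology Set

/-! ### Geometry of the standard simplex -/

/-- The `i`-th vertex of the standard simplex. -/
def vertex (k : ℕ) (i : Fin (k + 1)) : stdDelta k :=
  ⟨EuclideanSpace.single i 1, by
    constructor
    · intro j
      rw [PiLp.single_apply]
      split_ifs <;> norm_num
    · simp⟩

instance (k : ℕ) : Inhabited (stdDelta k) := ⟨vertex k 0⟩

theorem coord_le_one {k : ℕ} (t : stdDelta k) (i : Fin (k + 1)) : t.1 i ≤ 1 := by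
  rw [← t.2.2]
  exact Finset.single_le_sum (fun j _ => t.2.1 j) (Finset.mem_univ i)

theorem norm_le_one_of_mem_stdDelta {k : ℕ} (t : stdDelta k) : ‖t.1‖ ≤ 1 := by
  rw [EuclideanSpace.norm_eq, Real.sqrt_le_one, ← t.2.2]
  refine Finset.sum_le_sum fun i _ => ?_
  rw [Real.norm_eq_abs, sq_abs]
  nlinarith [t.2.1 i, coord_le_one t i]

theorem dist_le_two {k : ℕ} (t u : stdDelta k) : dist t u ≤ 2 := by
  rw [Subtype.dist_eq, dist_eq_norm]
  linarith [norm_sub_le t.1 u.1, norm_le_one_of_mem_stdDelta t, norm_le_one_of_mem_stdDelta u]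

theorem abs_coord_sub_le_dist {k : ℕ} (t u : stdDelta k) (i : Fin (k + 1)) :
    |t.1 i - u.1 i| ≤ dist t u := by
  rw [Subtype.dist_eq, dist_eq_norm]
  simpa using PiLp.norm_apply_le (t.1 - u.1) i

theorem sum_tail_eq {k : ℕ} (t : stdDelta (k + 1)) :
    ∑ j : Fin (k + 1), t.1 j.succ = 1 - t.1 0 := by
  have := t.2.2
  rw [Fin.sum_univ_succ] at this
  linarith

/-- The radial projection of `Δ^{k+1}` from its zeroth vertex to the opposite face. -/
def tailPt {k : ℕ} (t : stdDelta (k + 1)) : stdDelta k :=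
  if h : t.1 0 = 1 then default else
    ⟨WithLp.toLp 2 fun j => t.1 j.succ / (1 - t.1 0), by
      have h0 : 0 < 1 - t.1 0 := sub_pos.2 (lt_of_le_of_ne (coord_le_one t 0) h)
      constructor
      · intro j
        exact div_nonneg (t.2.1 _) h0.le
      · simp only
        rw [← Finset.sum_div, sum_tail_eq, div_self h0.ne']⟩

/-- At the zeroth vertex both sides vanish, so the default value of `tailPt` does no harm. -/
theorem mul_tailPt {k : ℕ} (t : stdDelta (k + 1)) (j : Fin (k + 1)) :
    (1 - t.1 0) * (tailPt t).1 j = t.1 j.succ := by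
  by_cases h : t.1 0 = 1
  · have h1 := sum_tail_eq t
    rw [h, sub_self] at h1
    have h2 := (Finset.sum_eq_zero_iff_of_nonneg fun j _ => t.2.1 (Fin.succ j)).1 h1 j
      (Finset.mem_univ j)
    simp [h, h2]
  · have h0 : 1 - t.1 0 ≠ 0 := sub_ne_zero.2 (Ne.symm h)
    simp only [tailPt, h, dite_false]
    field_simp

theorem norm_tail_sub_le {k : ℕ} (t u : stdDelta (k + 1)) :
    ‖(1 - t.1 0) • (tailPt t).1 - (1 - u.1 0) • (tailPt u).1‖ ≤ dist t u := by
  rw [Subtype.dist_eq, EuclideanSpace.dist_eq, EuclideanSpace.norm_eq]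
  refine Real.sqrt_le_sqrt ?_
  rw [Fin.sum_univ_succ (n := k + 1)]
  refine le_add_of_nonneg_of_le (by positivity) (le_of_eq (Finset.sum_congr rfl fun j _ => ?_))
  simp only [PiLp.sub_apply, PiLp.smul_apply, smul_eq_mul, mul_tailPt]
  rw [Real.dist_eq, Real.norm_eq_abs]

/-- Radial projection expands without bound near the zeroth vertex, but the weight `1 - u 0`
compensates. The same weight multiplies `edist z z'` in `IsConical.edist_le`, which is why cones of
Lipschitz simplices are Lipschitz. -/
theorem mul_dist_tailPt_le {k : ℕ} (t u : stdDelta (k + 1)) :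
    (1 - u.1 0) * dist (tailPt t) (tailPt u) ≤ 2 * dist t u := by
  have h0 : 0 ≤ 1 - u.1 0 := sub_nonneg.2 (coord_le_one u 0)
  have h1 : (1 - u.1 0) * dist (tailPt t) (tailPt u) =
      ‖(1 - u.1 0) • (tailPt t).1 - (1 - u.1 0) • (tailPt u).1‖ := by
    rw [← smul_sub, norm_smul, Subtype.dist_eq, dist_eq_norm, Real.norm_of_nonneg h0]
  have h2 : (1 - u.1 0) • (tailPt t).1 - (1 - u.1 0) • (tailPt u).1 =
      (t.1 0 - u.1 0) • (tailPt t).1 +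
      ((1 - t.1 0) • (tailPt t).1 - (1 - u.1 0) • (tailPt u).1) := by
    module
  rw [h1, h2, two_mul]
  refine (norm_add_le _ _).trans (add_le_add ?_ (norm_tail_sub_le t u))
  rw [norm_smul, Real.norm_eq_abs]
  exact (mul_le_of_le_one_right (abs_nonneg _) (norm_le_one_of_mem_stdDelta _)).trans
    (abs_coord_sub_le_dist t u 0)

theorem continuousAt_tailPt {k : ℕ} {t : stdDelta (k + 1)} (h : t.1 0 ≠ 1) :
    ContinuousAt tailPt t := by
  have h0 : 0 < 1 - t.1 0 := sub_pos.2 (lt_of_le_of_ne (coord_le_one t 0) h)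
  rw [ContinuousAt, tendsto_iff_dist_tendsto_zero]
  have h1 : Tendsto (fun u => 2 * dist u t / (1 - t.1 0)) (𝓝 t) (𝓝 0) := by
    have : Continuous fun u : stdDelta (k + 1) => 2 * dist u t / (1 - t.1 0) := by fun_prop
    simpa using this.tendsto t
  refine squeeze_zero (fun _ => dist_nonneg) (fun u => ?_) h1
  rw [le_div_iff₀ h0, mul_comm]
  exact mul_dist_tailPt_le u t

theorem coe_faceIncl_succAbove {k : ℕ} (i : Fin (k + 2)) (z : stdDelta k) (j : Fin (k + 1)) :
    (faceIncl k i z).1 (i.succAbove j) = z.1 j := by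
  simp [faceIncl]

theorem coe_faceIncl_same {k : ℕ} (i : Fin (k + 2)) (z : stdDelta k) :
    (faceIncl k i z).1 i = 0 := by
  simp [faceIncl]

theorem faceIncl_zero_coord_zero {k : ℕ} (z : stdDelta k) : (faceIncl k 0 z).1 0 = 0 :=
  coe_faceIncl_same 0 z

theorem faceIncl_succ_coord_zero {k : ℕ} (i : Fin (k + 1)) (z : stdDelta k) :
    (faceIncl k i.succ z).1 0 = z.1 0 := by
  simpa using coe_faceIncl_succAbove i.succ z 0

theorem tailPt_faceIncl_zero {k : ℕ} (z : stdDelta k) : tailPt (faceIncl k 0 z) = z := by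
  apply Subtype.ext
  ext j
  have := mul_tailPt (faceIncl k 0 z) j
  rw [faceIncl_zero_coord_zero, sub_zero, one_mul] at this
  rw [this]
  simpa using coe_faceIncl_succAbove 0 z j

/-- At the zeroth vertex both projections take default values, which need not agree. -/
theorem tailPt_faceIncl_succ {k : ℕ} (i : Fin (k + 2)) (z : stdDelta (k + 1)) (hz : z.1 0 ≠ 1) :
    tailPt (faceIncl (k + 1) i.succ z) = faceIncl k i (tailPt z) := by
  apply Subtype.ext
  ext j
  have h0 : 1 - z.1 0 ≠ 0 := sub_ne_zero.2 (Ne.symm hz)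
  refine mul_left_cancel₀ h0 ?_
  have := mul_tailPt (faceIncl (k + 1) i.succ z) j
  rw [faceIncl_succ_coord_zero] at this
  rw [this]
  refine Fin.succAboveCases i ?_ (fun l => ?_) j
  · rw [coe_faceIncl_same, coe_faceIncl_same, mul_zero]
  · rw [← Fin.succ_succAbove_succ, coe_faceIncl_succAbove, coe_faceIncl_succAbove, mul_tailPt]

/-! ### Lipschitz constants of simplices -/

section Lip

variable {X : Type*} [EMetricSpace X]

theorem lip_le {k : ℕ} {σ : Simplex X k} {L : ℝ≥0∞}
    (h : ∀ t u, edist (σ t) (σ u) ≤ L * edist t u) : lip σ ≤ L := by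
  induction L with
  | top => exact le_top
  | coe L => exact iInf₂_le L h

theorem edist_le_lip_mul {k : ℕ} (σ : Simplex X k) (t u : stdDelta k) :
    edist (σ t) (σ u) ≤ lip σ * edist t u := by
  rcases eq_or_ne t u with rfl | htu
  · simp
  rw [← ENNReal.div_le_iff (by simpa using htu) (edist_ne_top t u)]
  refine le_iInf₂ fun C hC => ?_
  rw [ENNReal.div_le_iff (by simpa using htu) (edist_ne_top t u)]
  exact hC t u

theorem lip_comp_le {k m : ℕ} (σ : Simplex X m)
    (α : Simplex (stdDelta m) k) : lip (σ.comp α) ≤ lip σ * lip α := by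
  refine lip_le fun t u => ?_
  rw [mul_assoc]
  exact (edist_le_lip_mul σ _ _).trans (mul_le_mul_right (edist_le_lip_mul α t u) _)

theorem lip_zero_dim (σ : Simplex X 0) : lip σ = 0 := by
  refine le_antisymm (lip_le fun t u => ?_) bot_le
  have : t = u := by
    apply Subtype.ext
    ext i
    have h1 := t.2.2
    have h2 := u.2.2
    rw [Fin.sum_univ_one] at h1 h2
    have hi : i = 0 := by omega
    rw [hi]
    exact h1.trans h2.symm
  simp [this]

end Lip

/-! ### Conical contractions and cones of singular simplices -/

/-- `κ s z`, for `s ∈ [0, 1]` and `z ∈ U`, contracts `U` to the point `p` along paths, with the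
metric distortion `C` of the linear contraction of a subset of a normed space. -/
structure IsConical {X : Type*} [EMetricSpace X] (C : ℝ≥0) (p : X) (U : Set X)
    (κ : ℝ → X → X) : Prop where
  zero : ∀ z ∈ U, κ 0 z = p
  one : ∀ z ∈ U, κ 1 z = z
  edist_center_le : ∀ z ∈ U, edist p z ≤ 2
  edist_le : ∀ s ∈ Icc (0 : ℝ) 1, ∀ s' ∈ Icc (0 : ℝ) 1, ∀ z ∈ U, ∀ z' ∈ U,
    edist (κ s z) (κ s' z') ≤
      C * (ENNReal.ofReal |s - s'| * edist p z + ENNReal.ofReal s' * edist z z')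

theorem IsConical.mono {X : Type*} [EMetricSpace X] {C : ℝ≥0} {p : X} {U V : Set X}
    {κ : ℝ → X → X} (h : IsConical C p U κ) (hV : V ⊆ U) : IsConical C p V κ :=
  ⟨fun z hz => h.zero z (hV hz), fun z hz => h.one z (hV hz),
    fun z hz => h.edist_center_le z (hV hz),
    fun s hs s' hs' z hz z' hz' => h.edist_le s hs s' hs' z (hV hz) z' (hV hz')⟩

theorem IsConical.edist_center_apply_le {X : Type*} [EMetricSpace X] {C : ℝ≥0} {p : X} {U : Set X}
    {κ : ℝ → X → X} (h : IsConical C p U κ) {s : ℝ} (hs : s ∈ Icc (0 : ℝ) 1) {z : X}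
    (hz : z ∈ U) : edist (κ s z) p ≤ C * edist p z := by
  have := h.edist_le s hs 0 (by simp) z hz z hz
  rw [h.zero z hz] at this
  refine this.trans ?_
  simp only [sub_zero, edist_self, mul_zero, add_zero]
  refine mul_le_mul_right (mul_le_of_le_one_left bot_le ?_) _
  rw [abs_of_nonneg hs.1]
  exact ENNReal.ofReal_le_one.2 hs.2

section Cone

variable {X : Type*} [EMetricSpace X] {C : ℝ≥0} {p : X} {U : Set X} {κ : ℝ → X → X}

/-- The function underlying the cone of a simplex. -/
def coneFun (κ : ℝ → X → X) {k : ℕ} (σ : Simplex X k) (t : stdDelta (k + 1)) : X :=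
  κ (1 - t.1 0) (σ (tailPt t))

open Classical in
/-- The cone of a singular simplex with respect to a contraction (with junk value if this is
not continuous). -/
def cone (κ : ℝ → X → X) {k : ℕ} (σ : Simplex X k) : Simplex X (k + 1) :=
  if h : Continuous (coneFun κ σ) then ⟨coneFun κ σ, h⟩ else ContinuousMap.const _ (σ default)

theorem one_sub_coord_mem {k : ℕ} (t : stdDelta (k + 1)) : 1 - t.1 0 ∈ Icc (0 : ℝ) 1 :=
  ⟨sub_nonneg.2 (coord_le_one t 0), sub_le_self _ (t.2.1 0)⟩

theorem edist_coneFun_le (h : IsConical C p U κ) {k : ℕ} {σ : Simplex X k} (hσ : range σ ⊆ U)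
    (t u : stdDelta (k + 1)) :
    edist (coneFun κ σ t) (coneFun κ σ u) ≤ C * (2 * edist t u +
      ENNReal.ofReal (1 - u.1 0) * edist (σ (tailPt t)) (σ (tailPt u))) := by
  refine (h.edist_le _ (one_sub_coord_mem t) _ (one_sub_coord_mem u) _ (hσ ⟨_, rfl⟩) _
    (hσ ⟨_, rfl⟩)).trans ?_
  refine mul_le_mul_right (add_le_add_left ?_ _) _
  rw [mul_comm]
  refine mul_le_mul' (h.edist_center_le _ (hσ ⟨_, rfl⟩)) ?_
  rw [edist_dist]
  refine ENNReal.ofReal_le_ofReal ?_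
  rw [show 1 - t.1 0 - (1 - u.1 0) = -(t.1 0 - u.1 0) by ring, abs_neg]
  exact abs_coord_sub_le_dist t u 0

theorem continuous_coneFun (h : IsConical C p U κ) {k : ℕ} {σ : Simplex X k} (hσ : range σ ⊆ U) :
    Continuous (coneFun κ σ) := by
  rw [continuous_iff_continuousAt]
  intro u
  rw [ContinuousAt, tendsto_iff_edist_tendsto_0]
  have key : Tendsto (fun t => (C : ℝ≥0∞) * (2 * edist t u +
      ENNReal.ofReal (1 - u.1 0) * edist (σ (tailPt t)) (σ (tailPt u)))) (𝓝 u) (𝓝 0) := by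
    have h1 : Tendsto (fun t : stdDelta (k + 1) => 2 * edist t u) (𝓝 u) (𝓝 0) := by
      have := ENNReal.Tendsto.const_mul (a := 2)
        (tendsto_iff_edist_tendsto_0.1 (tendsto_id (x := 𝓝 u))) (Or.inr (by simp))
      simpa using this
    have h2 : Tendsto (fun t : stdDelta (k + 1) =>
        ENNReal.ofReal (1 - u.1 0) * edist (σ (tailPt t)) (σ (tailPt u))) (𝓝 u) (𝓝 0) := by
      -- At the apex the weight is zero, so the discontinuity of `tailPt` there is harmless.
      by_cases hu : u.1 0 = 1
      · simp [hu]
      · have h3 := (σ.continuous.continuousAt (x := tailPt u)).comp (continuousAt_tailPt hu)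
        have := ENNReal.Tendsto.const_mul (a := ENNReal.ofReal (1 - u.1 0))
          (tendsto_iff_edist_tendsto_0.1 h3.tendsto) (Or.inr (by simp))
        simpa using this
    have := ENNReal.Tendsto.const_mul (a := (C : ℝ≥0∞)) (h1.add h2) (Or.inr (by simp))
    simpa using this
  exact tendsto_of_tendsto_of_tendsto_of_le_of_le tendsto_const_nhds key (fun _ => bot_le)
    (fun t => edist_coneFun_le h hσ t u)

theorem cone_apply (h : IsConical C p U κ) {k : ℕ} {σ : Simplex X k} (hσ : range σ ⊆ U)
    (t : stdDelta (k + 1)) : cone κ σ t = κ (1 - t.1 0) (σ (tailPt t)) := by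
  rw [cone, dif_pos (continuous_coneFun h hσ)]
  rfl

theorem range_cone_subset (h : IsConical C p U κ) {k : ℕ} {σ : Simplex X k} (hσ : range σ ⊆ U) :
    range (cone κ σ) ⊆ {x | ∃ z ∈ range σ, ∃ s ∈ Icc (0 : ℝ) 1, x = κ s z} := by
  rintro _ ⟨t, rfl⟩
  exact ⟨_, ⟨tailPt t, rfl⟩, _, one_sub_coord_mem t, cone_apply h hσ t⟩

/-- The first 2 bounds the distance to the apex (`edist_center_le`), the second comes from
`mul_dist_tailPt_le`. The bound involves nothing about `U` or `p`, so it can be iterated uniformly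
over the space. -/
theorem lip_cone_le (h : IsConical C p U κ) {k : ℕ} {σ : Simplex X k} (hσ : range σ ⊆ U) :
    lip (cone κ σ) ≤ C * (2 + 2 * lip σ) := by
  refine lip_le fun t u => ?_
  have h1 := edist_coneFun_le h hσ t u
  rw [cone, dif_pos (continuous_coneFun h hσ)]
  refine h1.trans ?_
  rw [mul_assoc, add_mul]
  refine mul_le_mul_right (add_le_add_right ?_ _) _
  calc _ ≤ ENNReal.ofReal (1 - u.1 0) * (lip σ * edist (tailPt t) (tailPt u)) := by
        gcongr; exact edist_le_lip_mul σ _ _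
    _ = lip σ * (ENNReal.ofReal (1 - u.1 0) * edist (tailPt t) (tailPt u)) := by ring
    _ ≤ lip σ * (2 * edist t u) := by
        refine mul_le_mul_right ?_ _
        rw [edist_dist, edist_dist, ← ENNReal.ofReal_mul (one_sub_coord_mem u).1]
        exact (ENNReal.ofReal_le_ofReal (mul_dist_tailPt_le t u)).trans_eq
          (by rw [ENNReal.ofReal_mul (by norm_num), ENNReal.ofReal_ofNat])
    _ = _ := by ring

theorem face_zero_cone (h : IsConical C p U κ) {k : ℕ} {σ : Simplex X k} (hσ : range σ ⊆ U) :
    face 0 (cone κ σ) = σ := by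
  ext z
  change cone κ σ (faceIncl k 0 z) = σ z
  rw [cone_apply h hσ, faceIncl_zero_coord_zero, tailPt_faceIncl_zero, sub_zero,
    h.one _ (hσ ⟨_, rfl⟩)]

theorem face_succ_cone (h : IsConical C p U κ) {k : ℕ} {σ : Simplex X (k + 1)} (hσ : range σ ⊆ U)
    (i : Fin (k + 2)) : face i.succ (cone κ σ) = cone κ (face i σ) := by
  ext z
  change cone κ σ (faceIncl _ i.succ z) = _
  rw [cone_apply h hσ, cone_apply h ((range_face_subset i σ).trans hσ), faceIncl_succ_coord_zero]
  -- At the apex both sides are `p`, because `κ 0` is constant on `U`.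
  by_cases hz : z.1 0 = 1
  · rw [hz, sub_self, h.zero _ (hσ ⟨_, rfl⟩),
      h.zero _ (hσ (range_face_subset i σ ⟨_, rfl⟩))]
  · rw [tailPt_faceIncl_succ i z hz]
    rfl

theorem face_one_cone_zero_dim (h : IsConical C p U κ) {σ : Simplex X 0} (hσ : range σ ⊆ U) :
    face 1 (cone κ σ) = ContinuousMap.const _ p := by
  ext z
  change cone κ σ (faceIncl 0 1 z) = p
  have hz : (faceIncl 0 1 z).1 0 = 1 := by
    have h1 := faceIncl_succ_coord_zero 0 z
    have h2 := z.2.2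
    rw [Fin.sum_univ_one] at h2
    rw [← h2, ← h1]
    rfl
  rw [cone_apply h hσ, hz, sub_self, h.zero _ (hσ ⟨_, rfl⟩)]

end Cone

/-! ### Chains supported on a set of simplices -/

section Chains

variable {X Y : Type*} [TopologicalSpace X] [TopologicalSpace Y]

/-- The chains all of whose simplices belong to `S`. -/
abbrev chainsIn {k : ℕ} (S : Set (Simplex X k)) : Submodule ℝ (Chain X k) :=
  Finsupp.supported ℝ ℝ S

theorem single_mem_chainsIn {k : ℕ} {S : Set (Simplex X k)} {σ : Simplex X k} (h : σ ∈ S) (a : ℝ) :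
    Finsupp.single σ a ∈ chainsIn S :=
  Finsupp.single_mem_supported ℝ a h

theorem chainsIn_mono {k : ℕ} {S S' : Set (Simplex X k)} (h : S ⊆ S') : chainsIn S ≤ chainsIn S' :=
  Finsupp.supported_mono h

theorem map_mem_of_mem_chainsIn {V : Type*} [AddCommGroup V] [Module ℝ V] {k : ℕ}
    {S : Set (Simplex X k)} {N : Submodule ℝ V} {f : Chain X k →ₗ[ℝ] V}
    (hf : ∀ σ ∈ S, f (Finsupp.single σ 1) ∈ N) {z : Chain X k} (hz : z ∈ chainsIn S) : f z ∈ N := by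
  rw [chainsIn, Finsupp.supported_eq_span_single] at hz
  refine Submodule.span_le (p := N.comap f).2 ?_ hz
  rintro _ ⟨σ, hσ, rfl⟩
  exact hf σ hσ

theorem map_eq_of_mem_chainsIn {V : Type*} [AddCommGroup V] [Module ℝ V] {k : ℕ}
    {S : Set (Simplex X k)} {f g : Chain X k →ₗ[ℝ] V}
    (hf : ∀ σ ∈ S, f (Finsupp.single σ 1) = g (Finsupp.single σ 1)) {z : Chain X k}
    (hz : z ∈ chainsIn S) : f z = g z := by
  have := map_mem_of_mem_chainsIn (N := ⊥) (f := f - g)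
    (fun σ hσ => by simpa [sub_eq_zero] using hf σ hσ) hz
  simpa [sub_eq_zero] using this

theorem chain_hom_ext {V : Type*} [AddCommGroup V] [Module ℝ V] {k : ℕ}
    {f g : Chain X k →ₗ[ℝ] V}
    (h : ∀ σ, f (Finsupp.single σ 1) = g (Finsupp.single σ 1)) : f = g :=
  Finsupp.lhom_ext' fun σ => LinearMap.ext_ring (h σ)

theorem bdry_mem_chainsIn {k : ℕ} {S : Set (Simplex X (k + 1))} {S' : Set (Simplex X k)}
    (h : ∀ σ ∈ S, ∀ i, face i σ ∈ S') {z : Chain X (k + 1)} (hz : z ∈ chainsIn S) :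
    bdry X k z ∈ chainsIn S' := by
  refine map_mem_of_mem_chainsIn (fun σ hσ => ?_) hz
  rw [bdry_single]
  exact Submodule.sum_mem _ fun i _ => Submodule.smul_mem _ _ (single_mem_chainsIn (h σ hσ i) 1)

/-- The augmentation of the singular chain complex. -/
def augmentation (X : Type*) [TopologicalSpace X] : Chain X 0 →ₗ[ℝ] ℝ :=
  Finsupp.linearCombination ℝ fun _ => 1

theorem augmentation_single (σ : Simplex X 0) : augmentation X (Finsupp.single σ 1) = 1 := by
  simp [augmentation]

/-- The cycles of the augmented singular chain complex. -/
def redCycles (X : Type*) [TopologicalSpace X] : ∀ k : ℕ, Submodule ℝ (Chain X k)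
  | 0 => LinearMap.ker (augmentation X)
  | k + 1 => LinearMap.ker (bdry X k)

theorem bdry_mem_redCycles (k : ℕ) (z : Chain X (k + 1)) : bdry X k z ∈ redCycles X k := by
  cases k with
  | zero =>
    change (augmentation X ∘ₗ bdry X 0) z = (0 : Chain X 1 →ₗ[ℝ] ℝ) z
    congr 1
    refine chain_hom_ext fun σ => ?_
    rw [LinearMap.comp_apply, bdry_single, Fin.sum_univ_two]
    simp [augmentation]
  | succ k => exact bdry_bdry k z

/-- The linear extension of a map defined on singular simplices. -/
abbrev linExt {V : Type*} [AddCommGroup V] [Module ℝ V] {k : ℕ} (f : Simplex X k → V) :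
    Chain X k →ₗ[ℝ] V :=
  Finsupp.linearCombination ℝ f

theorem linExt_single {V : Type*} [AddCommGroup V] [Module ℝ V] {k : ℕ} (f : Simplex X k → V)
    (σ : Simplex X k) : linExt f (Finsupp.single σ 1) = f σ := by
  simp

/-- The map induced on chains by a continuous map. -/
def pushChain (f : C(X, Y)) (k : ℕ) : Chain X k →ₗ[ℝ] Chain Y k :=
  linExt fun σ => Finsupp.single (f.comp σ) 1

theorem pushChain_single (f : C(X, Y)) {k : ℕ} (σ : Simplex X k) :
    pushChain f k (Finsupp.single σ 1) = Finsupp.single (f.comp σ) 1 :=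
  linExt_single _ _

theorem pushChain_pushChain {Z : Type*} [TopologicalSpace Z] (g : C(Y, Z)) (f : C(X, Y)) {k : ℕ}
    (z : Chain X k) : pushChain g k (pushChain f k z) = pushChain (g.comp f) k z := by
  refine LinearMap.congr_fun (f := pushChain g k ∘ₗ pushChain f k) (chain_hom_ext fun σ => ?_) z
  rw [LinearMap.comp_apply, pushChain_single, pushChain_single, pushChain_single]
  rfl

theorem bdry_pushChain (f : C(X, Y)) {k : ℕ} (z : Chain X (k + 1)) :
    bdry Y k (pushChain f (k + 1) z) = pushChain f k (bdry X k z) := by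
  refine LinearMap.congr_fun (f := bdry Y k ∘ₗ pushChain f (k + 1))
    (g := pushChain f k ∘ₗ bdry X k) (chain_hom_ext fun σ => ?_) z
  simp only [LinearMap.comp_apply, pushChain_single, bdry_single, map_sum, map_smul]
  rfl

theorem pushChain_mem_chainsIn (f : C(X, Y)) {k : ℕ} {S : Set (Simplex X k)}
    {S' : Set (Simplex Y k)} (h : ∀ σ ∈ S, f.comp σ ∈ S') {z : Chain X k} (hz : z ∈ chainsIn S) :
    pushChain f k z ∈ chainsIn S' :=
  map_mem_of_mem_chainsIn
    (fun σ hσ => by rw [pushChain_single]; exact single_mem_chainsIn (h σ hσ) 1) hz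

end Chains

/-! ### The cone operator on chains -/

section Cone

variable {X : Type*} [EMetricSpace X] {C : ℝ≥0} {p : X} {U : Set X} {κ : ℝ → X → X}

/-- The cone operator on chains. -/
def coneChain (κ : ℝ → X → X) (k : ℕ) : Chain X k →ₗ[ℝ] Chain X (k + 1) :=
  linExt fun σ => Finsupp.single (cone κ σ) 1

theorem coneChain_single {k : ℕ} (σ : Simplex X k) :
    coneChain κ k (Finsupp.single σ 1) = Finsupp.single (cone κ σ) 1 :=
  linExt_single _ _

theorem coneChain_mem_chainsIn {k : ℕ} {S : Set (Simplex X k)} {S' : Set (Simplex X (k + 1))}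
    (h : ∀ σ ∈ S, cone κ σ ∈ S') {z : Chain X k} (hz : z ∈ chainsIn S) :
    coneChain κ k z ∈ chainsIn S' :=
  map_mem_of_mem_chainsIn
    (fun σ hσ => by rw [coneChain_single]; exact single_mem_chainsIn (h σ hσ) 1) hz

theorem bdry_coneChain_succ (h : IsConical C p U κ) {k : ℕ} {z : Chain X (k + 1)}
    (hz : z ∈ chainsIn {σ | range σ ⊆ U}) :
    bdry X (k + 1) (coneChain κ (k + 1) z) = z - coneChain κ k (bdry X k z) := by
  refine map_eq_of_mem_chainsIn (f := bdry X (k + 1) ∘ₗ coneChain κ (k + 1))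
    (g := LinearMap.id - coneChain κ k ∘ₗ bdry X k) (fun σ hσ => ?_) hz
  simp only [LinearMap.comp_apply, LinearMap.sub_apply, LinearMap.id_apply, coneChain_single,
    bdry_single, map_sum, map_smul]
  rw [Fin.sum_univ_succ, face_zero_cone h hσ, sub_eq_add_neg, ← Finset.sum_neg_distrib]
  congr 1
  · simp
  · refine Finset.sum_congr rfl fun i _ => ?_
    rw [face_succ_cone h hσ, Fin.val_succ, pow_succ, mul_neg_one, neg_smul]

theorem bdry_coneChain_zero (h : IsConical C p U κ) {z : Chain X 0}
    (hz : z ∈ chainsIn {σ | range σ ⊆ U}) :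
    bdry X 0 (coneChain κ 0 z) =
      z - augmentation X z • Finsupp.single (ContinuousMap.const _ p) 1 := by
  refine map_eq_of_mem_chainsIn (f := bdry X 0 ∘ₗ coneChain κ 0)
    (g := LinearMap.id -
      (augmentation X).smulRight (Finsupp.single (ContinuousMap.const _ p) 1))
    (fun σ hσ => ?_) hz
  simp only [LinearMap.comp_apply, LinearMap.sub_apply, LinearMap.id_apply, coneChain_single,
    bdry_single, LinearMap.smulRight_apply, augmentation_single]
  rw [Fin.sum_univ_two, face_zero_cone h hσ, face_one_cone_zero_dim h hσ]
  simp [sub_eq_add_neg]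

/-- Coning fills cycles. Reduced cycles are used so that in degree zero the multiple of the apex
disappears too. -/
theorem bdry_coneChain (h : IsConical C p U κ) {k : ℕ} {z : Chain X k}
    (hz : z ∈ chainsIn {σ | range σ ⊆ U}) (hc : z ∈ redCycles X k) :
    bdry X k (coneChain κ k z) = z := by
  cases k with
  | zero =>
    have hc' : augmentation X z = 0 := hc
    rw [bdry_coneChain_zero h hz, hc', zero_smul, sub_zero]
  | succ k =>
    have hc' : bdry X k z = 0 := hc
    rw [bdry_coneChain_succ h hz, hc', map_zero, sub_zero]

end Cone

/-! ### The `ℓ¹`-distance and linear maps between standard simplices -/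

/-- The `ℓ¹`-distance on the standard simplex. -/
def l1Dist {k : ℕ} (t u : stdDelta k) : ℝ := ∑ i, |t.1 i - u.1 i|

theorem l1Dist_self {k : ℕ} (t : stdDelta k) : l1Dist t t = 0 := by simp [l1Dist]

theorem l1Dist_nonneg {k : ℕ} (t u : stdDelta k) : 0 ≤ l1Dist t u :=
  Finset.sum_nonneg fun _ _ => abs_nonneg _

theorem l1Dist_comm {k : ℕ} (t u : stdDelta k) : l1Dist t u = l1Dist u t :=
  Finset.sum_congr rfl fun _ _ => abs_sub_comm _ _

theorem l1Dist_le_two {k : ℕ} (t u : stdDelta k) : l1Dist t u ≤ 2 := by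
  have : l1Dist t u ≤ ∑ i, (t.1 i + u.1 i) :=
    Finset.sum_le_sum fun i _ => abs_sub_le_iff.2
      ⟨by linarith [t.2.1 i, u.2.1 i], by linarith [t.2.1 i, u.2.1 i]⟩
  rw [Finset.sum_add_distrib, t.2.2, u.2.2] at this
  linarith

theorem dist_le_l1Dist {k : ℕ} (t u : stdDelta k) : dist t u ≤ l1Dist t u := by
  rw [Subtype.dist_eq, EuclideanSpace.dist_eq]
  refine Real.sqrt_le_left (l1Dist_nonneg t u) |>.2 ?_ |>.trans le_rfl
  simp only [Real.dist_eq]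
  exact Finset.sum_sq_le_sq_sum_of_nonneg fun i _ => abs_nonneg _

theorem l1Dist_le_dist {k : ℕ} (t u : stdDelta k) : l1Dist t u ≤ (k + 1) * dist t u := by
  have : l1Dist t u ≤ ∑ _i : Fin (k + 1), dist t u :=
    Finset.sum_le_sum fun i _ => abs_coord_sub_le_dist t u i
  simpa using this

theorem l1Dist_faceIncl {k : ℕ} (i : Fin (k + 2)) (t u : stdDelta k) :
    l1Dist (faceIncl k i t) (faceIncl k i u) = l1Dist t u := by
  rw [l1Dist, Fin.sum_univ_succAbove _ i]
  simp [coe_faceIncl_same, coe_faceIncl_succAbove, l1Dist]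

theorem l1Dist_eq_zero_of_zero_dim (t u : stdDelta 0) : l1Dist t u = 0 := by
  have h1 := t.2.2
  have h2 := u.2.2
  rw [Fin.sum_univ_one] at h1 h2
  rw [l1Dist, Fin.sum_univ_one]
  simp only [Fin.isValue] at h1 h2 ⊢
  simp [h1, h2]

/-- `α` is the restriction of the linear map sending the `i`-th vertex to `w i`. -/
def IsLin {k m : ℕ} (α : Simplex (stdDelta m) k) (w : Fin (k + 1) → stdDelta m) : Prop :=
  ∀ t j, (α t).1 j = ∑ i, t.1 i * (w i).1 j

theorem isLin_id (k : ℕ) : IsLin (ContinuousMap.id (stdDelta k)) (vertex k) := by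
  intro t j
  simp [vertex]

theorem IsLin.faceIncl_comp {k m : ℕ} {α : Simplex (stdDelta m) k} {w : Fin (k + 1) → stdDelta m}
    (h : IsLin α w) (i : Fin (m + 2)) :
    IsLin ((face i (ContinuousMap.id (stdDelta (m + 1)))).comp α) (fun l => faceIncl m i (w l)) := by
  intro t j
  change (faceIncl m i (α t)).1 j = _
  refine Fin.succAboveCases i ?_ (fun l => ?_) j
  · simp [coe_faceIncl_same]
  · simp only [coe_faceIncl_succAbove]
    exact h t l

/-- Let `w i`, `i ≤ k`, be points of a simplex of `ℓ¹`-diameter at most `2 * c`. Then the linear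
map sending the `i`-th vertex of `Δ^k` to `w i` has `ℓ¹`-Lipschitz constant `c`. -/
theorem IsLin.l1Dist_le {k m : ℕ} {α : Simplex (stdDelta m) k} {w : Fin (k + 1) → stdDelta m}
    (h : IsLin α w) {c : ℝ} (hw : ∀ i j, l1Dist (w i) (w j) ≤ 2 * c) (t u : stdDelta k) :
    l1Dist (α t) (α u) ≤ c * l1Dist t u := by
  -- Pairing with the signs `ε` computes the `ℓ¹`-norm of `α t - α u`; the functional so obtained
  -- varies by at most `2 * c` over the points `w i`.
  let ε : Fin (m + 1) → ℝ := fun j => SignType.sign ((α t).1 j - (α u).1 j)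
  have hε : ∀ j, |ε j| ≤ 1 := by
    intro j
    rcases lt_trichotomy ((α t).1 j - (α u).1 j) 0 with h0 | h0 | h0 <;> simp [ε, h0]
  let f : Fin (k + 1) → ℝ := fun i => ∑ j, ε j * (w i).1 j
  have hf : ∀ i i', f i - f i' ≤ 2 * c := by
    intro i i'
    refine le_trans ?_ (hw i i')
    simp only [f]
    rw [← Finset.sum_sub_distrib]
    refine Finset.sum_le_sum fun j _ => ?_
    rw [← mul_sub]
    refine (le_abs_self _).trans ?_
    rw [abs_mul]
    exact mul_le_of_le_one_left (abs_nonneg _) (hε j)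
  obtain ⟨i₀, hi₀⟩ := Finite.exists_min f
  have h1 : l1Dist (α t) (α u) = ∑ i, (t.1 i - u.1 i) * f i := by
    have : l1Dist (α t) (α u) = ∑ j, ε j * ∑ i, (t.1 i - u.1 i) * (w i).1 j := by
      refine Finset.sum_congr rfl fun j _ => ?_
      rw [← sign_mul_self, h t j, h u j, ← Finset.sum_sub_distrib]
      simp only [ε, h t j, h u j, ← Finset.sum_sub_distrib, sub_mul]
    rw [this]
    simp only [f, Finset.mul_sum]
    rw [Finset.sum_comm]
    exact Finset.sum_congr rfl fun i _ => Finset.sum_congr rfl fun j _ => by ring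
  -- The coordinates of `t - u` sum to zero, so a constant may be subtracted from `f`. With `min f +
  -- c` the values lie in `[-c, c]`.
  have h2 : ∑ i, (t.1 i - u.1 i) * f i = ∑ i, (t.1 i - u.1 i) * (f i - (f i₀ + c)) := by
    simp only [mul_sub]
    rw [Finset.sum_sub_distrib, ← Finset.sum_mul, Finset.sum_sub_distrib, t.2.2, u.2.2]
    simp
  rw [h1, h2, l1Dist, Finset.mul_sum]
  refine Finset.sum_le_sum fun i _ => (le_abs_self _).trans ?_
  rw [abs_mul, mul_comm]
  refine mul_le_mul_of_nonneg_right (abs_le.2 ⟨?_, ?_⟩) (abs_nonneg _)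
  · linarith [hi₀ i]
  · linarith [hf i i₀]

theorem IsLin.l1Dist_le_self {k m : ℕ} {α : Simplex (stdDelta m) k}
    {w : Fin (k + 1) → stdDelta m} (h : IsLin α w) (t u : stdDelta k) :
    l1Dist (α t) (α u) ≤ l1Dist t u := by
  simpa using h.l1Dist_le (c := 1) (fun i j => by simpa using l1Dist_le_two _ _) t u

/-- Comparing `ℓ¹` and `ℓ²` costs a factor `k + 1`. For an iterated subdivision it is paid once, for
the whole composite, and not at every stage. -/
theorem lip_le_of_l1Dist_le {k m : ℕ} {α : Simplex (stdDelta m) k}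
    (h : ∀ t u, l1Dist (α t) (α u) ≤ l1Dist t u) : lip α ≤ k + 1 := by
  refine lip_le fun t u => ?_
  rw [edist_dist, edist_dist]
  refine (ENNReal.ofReal_le_ofReal (((dist_le_l1Dist _ _).trans (h t u)).trans
    (l1Dist_le_dist t u))).trans_eq ?_
  rw [ENNReal.ofReal_mul (by positivity)]
  congr
  exact_mod_cast ENNReal.ofReal_natCast (k + 1)

/-! ### Contraction to the barycentre -/

/-- The barycentre of the standard simplex. -/
def barycentre (k : ℕ) : stdDelta k :=
  ⟨WithLp.toLp 2 fun _ => ((k : ℝ) + 1)⁻¹, fun _ => by positivity, by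
    simp [mul_inv_cancel₀ (Nat.cast_add_one_ne_zero (R := ℝ) k)]⟩

theorem l1Dist_barycentre_le (k : ℕ) (w : stdDelta k) :
    l1Dist (barycentre k) w ≤ 2 * (k / (k + 1)) := by
  have hk : (0 : ℝ) < k + 1 := by positivity
  -- On `[0, 1]` the convex function `x ↦ |(k + 1)⁻¹ - x|` lies below its chord, whose end values
  -- are `1 / (k + 1)` and `k / (k + 1)`.
  have : l1Dist (barycentre k) w ≤ ∑ j, (((k : ℝ) + 1)⁻¹ + w.1 j * ((k - 1) / (k + 1))) := by
    refine Finset.sum_le_sum fun j _ => ?_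
    have h0 := w.2.1 j
    have h1 := coord_le_one w j
    have hk0 : (0 : ℝ) ≤ k := by positivity
    simp only [barycentre]
    rw [abs_sub_le_iff]
    constructor
    · field_simp
      nlinarith
    · field_simp
      nlinarith
  refine this.trans (le_of_eq ?_)
  rw [Finset.sum_add_distrib, ← Finset.sum_mul, w.2.2]
  simp
  field_simp
  ring

open Classical in
/-- The linear contraction of the standard simplex to its barycentre. -/
def baryContr (k : ℕ) (s : ℝ) (z : stdDelta k) : stdDelta k :=
  if h : s ∈ Icc (0 : ℝ) 1 then
    ⟨(1 - s) • (barycentre k).1 + s • z.1, by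
      constructor
      · intro i
        have h1 := (barycentre k).2.1 i
        have h2 := z.2.1 i
        have h3 := sub_nonneg.2 h.2
        have h4 := h.1
        simp only [PiLp.add_apply, PiLp.smul_apply, smul_eq_mul]
        positivity
      · simp only [PiLp.add_apply, PiLp.smul_apply, smul_eq_mul]
        rw [Finset.sum_add_distrib, ← Finset.mul_sum, ← Finset.mul_sum, z.2.2, (barycentre k).2.2]
        ring⟩
  else z

theorem coe_baryContr {k : ℕ} {s : ℝ} (hs : s ∈ Icc (0 : ℝ) 1) (z : stdDelta k) :
    (baryContr k s z).1 = (1 - s) • (barycentre k).1 + s • z.1 := by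
  rw [baryContr, dif_pos hs]

theorem isConical_baryContr (k : ℕ) : IsConical 1 (barycentre k) univ (baryContr k) where
  zero z _ := Subtype.ext (by rw [coe_baryContr (by simp)]; simp)
  one z _ := Subtype.ext (by rw [coe_baryContr (by simp)]; simp)
  edist_center_le z _ := by
    rw [edist_dist]
    exact (ENNReal.ofReal_le_ofReal (dist_le_two _ _)).trans_eq (by simp)
  edist_le s hs s' hs' z _ z' _ := by
    rw [ENNReal.coe_one, one_mul, edist_dist, edist_dist, edist_dist,
      ← ENNReal.ofReal_mul (abs_nonneg _), ← ENNReal.ofReal_mul hs'.1,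
      ← ENNReal.ofReal_add (by positivity) (mul_nonneg hs'.1 dist_nonneg)]
    refine ENNReal.ofReal_le_ofReal ?_
    rw [Subtype.dist_eq, Subtype.dist_eq, Subtype.dist_eq, coe_baryContr hs, coe_baryContr hs',
      dist_comm (barycentre k).1, dist_eq_norm, dist_eq_norm, dist_eq_norm]
    have : (1 - s) • (barycentre k).1 + s • z.1 - ((1 - s') • (barycentre k).1 + s' • z'.1) =
        (s - s') • (z.1 - (barycentre k).1) + s' • (z.1 - z'.1) := by module
    rw [this]
    refine (norm_add_le _ _).trans_eq ?_
    rw [norm_smul, norm_smul, Real.norm_eq_abs, Real.norm_of_nonneg hs'.1]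

theorem IsLin.cone_baryContr {k m : ℕ} {α : Simplex (stdDelta m) k}
    {w : Fin (k + 1) → stdDelta m} (h : IsLin α w) :
    IsLin (cone (baryContr m) α) (Fin.cons (barycentre m) w) := by
  intro t j
  rw [cone_apply (isConical_baryContr m) (subset_univ _), coe_baryContr (one_sub_coord_mem t)]
  simp only [PiLp.add_apply, PiLp.smul_apply, smul_eq_mul, h _ j, Fin.sum_univ_succ (n := k + 1),
    Fin.cons_zero, Fin.cons_succ, Finset.mul_sum, ← mul_assoc, mul_tailPt]
  ring

/-! ### Barycentric subdivision -/

/-- The identity of the standard simplex, as a singular chain. -/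
abbrev idChain (k : ℕ) : Chain (stdDelta k) k := Finsupp.single (ContinuousMap.id _) 1

/-- The barycentric subdivision of the standard simplex. -/
def subdivPiece : ∀ k, Chain (stdDelta k) k
  | 0 => idChain 0
  | k + 1 => coneChain (baryContr (k + 1)) k
      (linExt (fun σ => pushChain σ k (subdivPiece k)) (bdry _ k (idChain (k + 1))))

/-- The universal chain for the homotopy between barycentric subdivision and the identity. -/
def subdivHomPiece : ∀ k, Chain (stdDelta k) (k + 1)
  | 0 => 0
  | k + 1 => coneChain (baryContr (k + 1)) (k + 1)
      (idChain (k + 1) - subdivPiece (k + 1) -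
        linExt (fun σ => pushChain σ (k + 1) (subdivHomPiece k)) (bdry _ k (idChain (k + 1))))

section Subdivision

variable (X : Type*) [TopologicalSpace X]

/-- The barycentric subdivision operator. -/
def subdiv (k : ℕ) : Chain X k →ₗ[ℝ] Chain X k :=
  linExt fun σ => pushChain σ k (subdivPiece k)

/-- The homotopy between barycentric subdivision and the identity. -/
def subdivHom (k : ℕ) : Chain X k →ₗ[ℝ] Chain X (k + 1) :=
  linExt fun σ => pushChain σ (k + 1) (subdivHomPiece k)

variable {X} {Y : Type*} [TopologicalSpace Y]

theorem subdiv_single {k : ℕ} (σ : Simplex X k) :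
    subdiv X k (Finsupp.single σ 1) = pushChain σ k (subdivPiece k) := linExt_single _ _

theorem subdivHom_single {k : ℕ} (σ : Simplex X k) :
    subdivHom X k (Finsupp.single σ 1) = pushChain σ (k + 1) (subdivHomPiece k) :=
  linExt_single _ _

theorem pushChain_subdiv (f : C(X, Y)) {k : ℕ} (z : Chain X k) :
    pushChain f k (subdiv X k z) = subdiv Y k (pushChain f k z) := by
  refine LinearMap.congr_fun (f := pushChain f k ∘ₗ subdiv X k)
    (g := subdiv Y k ∘ₗ pushChain f k) (chain_hom_ext fun σ => ?_) z
  rw [LinearMap.comp_apply, LinearMap.comp_apply, subdiv_single, pushChain_single, subdiv_single,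
    pushChain_pushChain]

theorem pushChain_subdivHom (f : C(X, Y)) {k : ℕ} (z : Chain X k) :
    pushChain f (k + 1) (subdivHom X k z) = subdivHom Y k (pushChain f k z) := by
  refine LinearMap.congr_fun (f := pushChain f (k + 1) ∘ₗ subdivHom X k)
    (g := subdivHom Y k ∘ₗ pushChain f k) (chain_hom_ext fun σ => ?_) z
  rw [LinearMap.comp_apply, LinearMap.comp_apply, subdivHom_single, pushChain_single,
    subdivHom_single, pushChain_pushChain]

theorem pushChain_idChain {k : ℕ} (σ : Simplex X k) :
    pushChain σ k (idChain k) = Finsupp.single σ 1 := by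
  rw [pushChain_single]
  rfl

theorem subdiv_zero : subdiv X 0 = LinearMap.id :=
  chain_hom_ext fun σ => by
    rw [subdiv_single]
    exact pushChain_idChain σ

theorem subdivHom_zero : subdivHom X 0 = 0 :=
  chain_hom_ext fun σ => by
    rw [subdivHom_single]
    exact map_zero _

/-- By naturality the identity simplex is the universal case. It stays a hypothesis because the
induction in `bdry_subdivPiece` needs the result for all chains one degree lower. -/
theorem bdry_subdiv_of_bdry_subdivPiece {k : ℕ}
    (h : bdry _ k (subdivPiece (k + 1)) = subdiv _ k (bdry _ k (idChain (k + 1))))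
    (z : Chain X (k + 1)) : bdry X k (subdiv X (k + 1) z) = subdiv X k (bdry X k z) := by
  refine LinearMap.congr_fun (f := bdry X k ∘ₗ subdiv X (k + 1))
    (g := subdiv X k ∘ₗ bdry X k) (chain_hom_ext fun σ => ?_) z
  rw [LinearMap.comp_apply, LinearMap.comp_apply, subdiv_single, bdry_pushChain, h,
    pushChain_subdiv, ← bdry_pushChain, pushChain_idChain]

theorem mem_chainsIn_univ_range {k m : ℕ} (z : Chain (stdDelta m) k) :
    z ∈ chainsIn {σ : Simplex (stdDelta m) k | range σ ⊆ univ} := by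
  simp [chainsIn]

/-- The piece is the cone over the subdivided boundary, which is a cycle by induction, so coning
fills it. -/
theorem bdry_subdivPiece (k : ℕ) :
    bdry _ k (subdivPiece (k + 1)) = subdiv _ k (bdry _ k (idChain (k + 1))) := by
  induction k with
  | zero =>
    refine bdry_coneChain (isConical_baryContr 1) (mem_chainsIn_univ_range _) ?_
    change subdiv _ 0 _ ∈ _
    rw [subdiv_zero]
    exact bdry_mem_redCycles 0 _
  | succ k ih =>
    refine bdry_coneChain (isConical_baryContr _) (mem_chainsIn_univ_range _) ?_
    change bdry _ k (subdiv _ (k + 1) _) = 0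
    rw [bdry_subdiv_of_bdry_subdivPiece ih, bdry_bdry, map_zero]

theorem bdry_subdiv {k : ℕ} (z : Chain X (k + 1)) :
    bdry X k (subdiv X (k + 1) z) = subdiv X k (bdry X k z) :=
  bdry_subdiv_of_bdry_subdivPiece (bdry_subdivPiece k) z

theorem bdry_subdivHom_of_bdry_subdivHomPiece {k : ℕ}
    (h : bdry _ (k + 1) (subdivHomPiece (k + 1)) =
      idChain (k + 1) - subdivPiece (k + 1) - subdivHom _ k (bdry _ k (idChain (k + 1))))
    (z : Chain X (k + 1)) : bdry X (k + 1) (subdivHom X (k + 1) z) =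
      z - subdiv X (k + 1) z - subdivHom X k (bdry X k z) := by
  refine LinearMap.congr_fun (f := bdry X (k + 1) ∘ₗ subdivHom X (k + 1))
    (g := LinearMap.id - subdiv X (k + 1) - subdivHom X k ∘ₗ bdry X k)
    (chain_hom_ext fun σ => ?_) z
  simp only [LinearMap.comp_apply, LinearMap.sub_apply, LinearMap.id_apply]
  rw [subdivHom_single, bdry_pushChain, h, map_sub, map_sub,
    pushChain_subdivHom, ← bdry_pushChain, pushChain_idChain, subdiv_single]

theorem bdry_subdivHomPiece (k : ℕ) :
    bdry _ (k + 1) (subdivHomPiece (k + 1)) =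
      idChain (k + 1) - subdivPiece (k + 1) - subdivHom _ k (bdry _ k (idChain (k + 1))) := by
  induction k with
  | zero =>
    refine bdry_coneChain (isConical_baryContr 1) (mem_chainsIn_univ_range _) ?_
    change bdry _ 0 (_ - _ - subdivHom _ 0 _) = 0
    rw [subdivHom_zero, LinearMap.zero_apply, sub_zero, map_sub, bdry_subdivPiece, subdiv_zero]
    exact sub_self _
  | succ k ih =>
    refine bdry_coneChain (isConical_baryContr _) (mem_chainsIn_univ_range _) ?_
    change bdry _ (k + 1) (_ - _ - subdivHom _ (k + 1) _) = 0
    rw [map_sub, map_sub, bdry_subdivPiece, bdry_subdivHom_of_bdry_subdivHomPiece ih, bdry_bdry,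
      map_zero, sub_zero, sub_self]

theorem bdry_subdivHom {k : ℕ} (z : Chain X (k + 1)) : bdry X (k + 1) (subdivHom X (k + 1) z) =
    z - subdiv X (k + 1) z - subdivHom X k (bdry X k z) :=
  bdry_subdivHom_of_bdry_subdivHomPiece (bdry_subdivHomPiece k) z

end Subdivision

/-! ### The simplices of the barycentric subdivision -/

theorem subdiv_bdry_idChain_mem {k : ℕ} {S : Set (Simplex (stdDelta k) k)}
    {S' : Set (Simplex (stdDelta (k + 1)) k)} (h : subdivPiece k ∈ chainsIn S)
    (hS : ∀ α ∈ S, ∀ i, (face i (ContinuousMap.id _)).comp α ∈ S') :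
    subdiv _ k (bdry _ k (idChain (k + 1))) ∈ chainsIn S' := by
  rw [bdry_single, map_sum]
  refine Submodule.sum_mem _ fun i _ => ?_
  rw [map_smul, subdiv_single]
  exact Submodule.smul_mem _ _ (pushChain_mem_chainsIn _ (fun α hα => hS α hα i) h)

theorem subdivHom_bdry_idChain_mem {k : ℕ} {S : Set (Simplex (stdDelta k) (k + 1))}
    {S' : Set (Simplex (stdDelta (k + 1)) (k + 1))} (h : subdivHomPiece k ∈ chainsIn S)
    (hS : ∀ α ∈ S, ∀ i, (face i (ContinuousMap.id _)).comp α ∈ S') :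
    subdivHom _ k (bdry _ k (idChain (k + 1))) ∈ chainsIn S' := by
  rw [bdry_single, map_sum]
  refine Submodule.sum_mem _ fun i _ => ?_
  rw [map_smul, subdivHom_single]
  exact Submodule.smul_mem _ _ (pushChain_mem_chainsIn _ (fun α hα => hS α hα i) h)

theorem div_succ_mono {a b : ℕ} (h : a ≤ b) : (a : ℝ) / (a + 1) ≤ b / (b + 1) := by
  have : (a : ℝ) ≤ b := by exact_mod_cast h
  rw [div_le_div_iff₀ (by positivity) (by positivity)]
  linarith

/-- Two vertices of a piece either come from a common face, where induction gives a smaller bound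
since `k / (k + 1)` increases with `k`, or one of them is the barycentre. -/
theorem subdivPiece_mem (k : ℕ) : subdivPiece k ∈ chainsIn
    {α : Simplex (stdDelta k) k |
      ∃ w, IsLin α w ∧ ∀ i j, l1Dist (w i) (w j) ≤ 2 * ((k : ℝ) / (k + 1))} := by
  induction k with
  | zero =>
    refine single_mem_chainsIn ?_ 1
    exact ⟨_, isLin_id 0, fun i j => by rw [l1Dist_eq_zero_of_zero_dim]; simp⟩
  | succ k ih =>
    refine coneChain_mem_chainsIn ?_ (subdiv_bdry_idChain_mem ih
      (S' := {α | ∃ w, IsLin α w ∧ ∀ i j, l1Dist (w i) (w j) ≤ 2 * ((k : ℝ) / (k + 1))}) ?_)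
    · rintro α ⟨w, hα, hw⟩
      refine ⟨_, hα.cone_baryContr, fun i j => ?_⟩
      have hk : 2 * ((k : ℝ) / (k + 1)) ≤ 2 * (((k + 1 : ℕ) : ℝ) / ((k + 1 : ℕ) + 1)) :=
        mul_le_mul_of_nonneg_left (div_succ_mono k.le_succ) (by norm_num)
      refine Fin.cases ?_ (fun i => ?_) i <;> refine Fin.cases ?_ (fun j => ?_) j
      · rw [l1Dist_self]
        positivity
      · exact l1Dist_barycentre_le (k + 1) _
      · rw [l1Dist_comm]
        exact l1Dist_barycentre_le (k + 1) _
      · exact (hw i j).trans hk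
    · rintro α ⟨w, hα, hw⟩ i
      refine ⟨_, hα.faceIncl_comp i, fun a b => ?_⟩
      rw [l1Dist_faceIncl]
      exact hw a b

theorem subdivHomPiece_mem (k : ℕ) : subdivHomPiece k ∈ chainsIn {α | ∃ w, IsLin α w} := by
  induction k with
  | zero => exact Submodule.zero_mem _
  | succ k ih =>
    refine coneChain_mem_chainsIn (S := {α | ∃ w, IsLin α w}) ?_
      (Submodule.sub_mem _ (Submodule.sub_mem _ ?_ ?_) (subdivHom_bdry_idChain_mem ih ?_))
    · rintro α ⟨w, hα⟩
      exact ⟨_, hα.cone_baryContr⟩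
    · refine single_mem_chainsIn ?_ 1
      exact ⟨_, isLin_id _⟩
    · refine chainsIn_mono ?_ (subdivPiece_mem (k + 1))
      rintro α ⟨w, hα, -⟩
      exact ⟨w, hα⟩
    · rintro α ⟨w, hα⟩ i
      exact ⟨_, hα.faceIncl_comp i⟩

/-! ### Iterated subdivision -/

section Iterate

variable {X : Type*} [TopologicalSpace X]

/-- The self-maps of `Δ^k` with the contraction factor of an `i`-fold barycentric subdivision. -/
def contractions (k i : ℕ) : Set (Simplex (stdDelta k) k) :=
  {α | ∀ t u, l1Dist (α t) (α u) ≤ ((k : ℝ) / (k + 1)) ^ i * l1Dist t u}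

/-- Each piece is `σ` precomposed with a composite of `i` linear maps, and their `ℓ¹`-contraction
factors multiply. -/
theorem subdiv_pow_mem {k : ℕ} (i : ℕ) (σ : Simplex X k) :
    (subdiv X k ^ i) (Finsupp.single σ 1) ∈
      chainsIn {τ | ∃ α ∈ contractions k i, τ = σ.comp α} := by
  induction i with
  | zero =>
    refine single_mem_chainsIn ?_ 1
    exact ⟨ContinuousMap.id _, fun t u => by simp, rfl⟩
  | succ i ih =>
    rw [pow_succ', Module.End.mul_apply]
    refine map_mem_of_mem_chainsIn ?_ ih
    rintro _ ⟨α, hα, rfl⟩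
    rw [subdiv_single]
    refine pushChain_mem_chainsIn _ ?_ (subdivPiece_mem k)
    rintro β ⟨w, hβ, hw⟩
    refine ⟨α.comp β, fun t u => (hα _ _).trans ?_, rfl⟩
    rw [pow_succ, mul_assoc]
    exact mul_le_mul_of_nonneg_left (hβ.l1Dist_le hw t u) (by positivity)

theorem subdivHom_subdiv_pow_mem {k : ℕ} (i : ℕ) (σ : Simplex X k) :
    subdivHom X k ((subdiv X k ^ i) (Finsupp.single σ 1)) ∈
      chainsIn {τ | ∃ α ∈ contractions k i, ∃ β : Simplex (stdDelta k) (k + 1),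
        (∀ t u, l1Dist (β t) (β u) ≤ l1Dist t u) ∧ τ = (σ.comp α).comp β} := by
  refine map_mem_of_mem_chainsIn ?_ (subdiv_pow_mem i σ)
  rintro _ ⟨α, hα, rfl⟩
  rw [subdivHom_single]
  refine pushChain_mem_chainsIn _ ?_ (subdivHomPiece_mem k)
  rintro β ⟨w, hβ⟩
  exact ⟨α, hα, β, hβ.l1Dist_le_self, rfl⟩

theorem bdry_subdiv_pow {k : ℕ} (i : ℕ) (z : Chain X (k + 1)) :
    bdry X k ((subdiv X (k + 1) ^ i) z) = (subdiv X k ^ i) (bdry X k z) := by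
  induction i generalizing z with
  | zero => rfl
  | succ i ih => rw [pow_succ, pow_succ, Module.End.mul_apply, Module.End.mul_apply, ih, bdry_subdiv]

variable (X) in
/-- The homotopy between the identity and the `m`-fold subdivision. -/
def iterHom (k m : ℕ) : Chain X k →ₗ[ℝ] Chain X (k + 1) :=
  ∑ i ∈ Finset.range m, subdivHom X k ∘ₗ (subdiv X k ^ i)

theorem iterHom_apply (k m : ℕ) (z : Chain X k) :
    iterHom X k m z = ∑ i ∈ Finset.range m, subdivHom X k ((subdiv X k ^ i) z) := by
  simp [iterHom]

/-- The homotopy formula for one subdivision, summed over the iterates, telescopes. -/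
theorem bdry_iterHom {k : ℕ} (m : ℕ) (z : Chain X (k + 1)) :
    bdry X (k + 1) (iterHom X (k + 1) m z) =
      z - (subdiv X (k + 1) ^ m) z - iterHom X k m (bdry X k z) := by
  rw [iterHom_apply, iterHom_apply, map_sum]
  induction m with
  | zero => simp
  | succ m ih =>
    rw [Finset.sum_range_succ, ih, Finset.sum_range_succ, bdry_subdivHom, pow_succ',
      Module.End.mul_apply, bdry_subdiv_pow]
    abel

end Iterate

/-! ### Deforming the singular chain complex along a homotopy -/

section Deform

variable {X : Type*} [TopologicalSpace X]

/-- The chain map `id - ∂ H - H ∂`. -/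
def deform (H : ∀ k, Chain X k →ₗ[ℝ] Chain X (k + 1)) : ∀ k, Chain X k →ₗ[ℝ] Chain X k
  | 0 => LinearMap.id - bdry X 0 ∘ₗ H 0
  | k + 1 => LinearMap.id - bdry X (k + 1) ∘ₗ H (k + 1) - H k ∘ₗ bdry X k

theorem deform_zero_apply (H : ∀ k, Chain X k →ₗ[ℝ] Chain X (k + 1)) (z : Chain X 0) :
    deform H 0 z = z - bdry X 0 (H 0 z) := rfl

theorem deform_succ_apply (H : ∀ k, Chain X k →ₗ[ℝ] Chain X (k + 1)) {k : ℕ}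
    (z : Chain X (k + 1)) :
    deform H (k + 1) z = z - bdry X (k + 1) (H (k + 1) z) - H k (bdry X k z) := rfl

theorem bdry_deform (H : ∀ k, Chain X k →ₗ[ℝ] Chain X (k + 1)) {k : ℕ} (z : Chain X (k + 1)) :
    bdry X k (deform H (k + 1) z) = deform H k (bdry X k z) := by
  rw [deform_succ_apply, map_sub, map_sub, bdry_bdry, sub_zero]
  cases k with
  | zero => rfl
  | succ k => rw [deform_succ_apply, bdry_bdry, map_zero, sub_zero]

end Deform

/-! ### Subdivision into small simplices -/

section Small

variable {X : Type*} [EMetricSpace X]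

/-- All parts of `Δ^k` of the size of an `m`-fold barycentric subdivision have small image. -/
def IsFine (Small : Set X → Prop) {k : ℕ} (m : ℕ) (σ : Simplex X k) : Prop :=
  ∀ A : Set (stdDelta k), (∀ t ∈ A, ∀ u ∈ A, l1Dist t u ≤ ((k : ℝ) / (k + 1)) ^ m * 2) →
    Small (σ '' A)

open Classical in
/-- The least number of barycentric subdivisions making a simplex fine. -/
def fineness (Small : Set X → Prop) {k : ℕ} (σ : Simplex X k) : ℕ :=
  if h : ∃ m, IsFine Small m σ then Nat.find h else 0

variable {Small : Set X → Prop}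

theorem isFine_of_fineness_le (h : ∀ (k : ℕ) (σ : Simplex X k), ∃ m, IsFine Small m σ) {k m : ℕ}
    {σ : Simplex X k} (hm : fineness Small σ ≤ m) : IsFine Small m σ := by
  classical
  rw [fineness, dif_pos (h k σ)] at hm
  refine fun A hA => Nat.find_spec (h k σ) A fun t ht u hu => (hA t ht u hu).trans ?_
  refine mul_le_mul_of_nonneg_right (pow_le_pow_of_le_one (by positivity) ?_ hm) (by norm_num)
  rw [div_le_one (by positivity)]
  linarith

/-- Faces are `ℓ¹`-isometrically embedded and their mesh factor `k / (k + 1)` is smaller, so they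
need no more subdivisions. This monotonicity allows the number of subdivisions to vary with the
simplex. -/
theorem fineness_face_le (h : ∀ (k : ℕ) (σ : Simplex X k), ∃ m, IsFine Small m σ) {k : ℕ}
    (σ : Simplex X (k + 1)) (i : Fin (k + 2)) : fineness Small (face i σ) ≤ fineness Small σ := by
  classical
  have h1 := isFine_of_fineness_le h (le_refl (fineness Small σ))
  rw [fineness, dif_pos (h k _)]
  refine Nat.find_min' _ fun A hA => ?_
  have : face i σ '' A = σ '' (faceIncl k i '' A) := by rw [← image_comp]; rfl
  rw [this]
  refine h1 _ ?_
  rintro _ ⟨t, ht, rfl⟩ _ ⟨u, hu, rfl⟩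
  rw [l1Dist_faceIncl]
  refine (hA t ht u hu).trans (mul_le_mul_of_nonneg_right ?_ (by norm_num))
  exact pow_le_pow_left₀ (by positivity) (div_succ_mono k.le_succ) _

theorem IsFine.small_range_comp {k m : ℕ} {σ : Simplex X k} (h : IsFine Small m σ)
    {α : Simplex (stdDelta k) k} (hα : α ∈ contractions k m) : Small (range (σ.comp α)) := by
  have : range (σ.comp α) = σ '' (range α) := range_comp σ α
  rw [this]
  refine h _ ?_
  rintro _ ⟨t, rfl⟩ _ ⟨u, rfl⟩
  exact (hα t u).trans (mul_le_mul_of_nonneg_left (l1Dist_le_two _ _) (by positivity))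

/-- The homotopy between the identity and adapted barycentric subdivision. -/
def adaptHom (Small : Set X → Prop) (k : ℕ) : Chain X k →ₗ[ℝ] Chain X (k + 1) :=
  linExt fun σ => iterHom X k (fineness Small σ) (Finsupp.single σ 1)

theorem adaptHom_single {k : ℕ} (σ : Simplex X k) :
    adaptHom Small k (Finsupp.single σ 1) =
      iterHom X k (fineness Small σ) (Finsupp.single σ 1) := linExt_single _ _

/-- The number of summands is not controlled by `lip σ`, but each one is `σ` precomposed with an
`ℓ¹`-nonexpanding map from `Δ^(k+1)`, whence the factor `k + 2`. -/
theorem adaptHom_mem {k : ℕ} (σ : Simplex X k) :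
    adaptHom Small k (Finsupp.single σ 1) ∈
      chainsIn {τ | range τ ⊆ range σ ∧ lip τ ≤ lip σ * (k + 2)} := by
  rw [adaptHom_single, iterHom_apply]
  refine Submodule.sum_mem _ fun i _ => chainsIn_mono ?_ (subdivHom_subdiv_pow_mem i σ)
  rintro _ ⟨α, hα, β, hβ, rfl⟩
  refine ⟨range_comp_subset_range (α.comp β) σ, ?_⟩
  rw [ContinuousMap.comp_assoc]
  refine (lip_comp_le σ (α.comp β)).trans (mul_le_mul_right ?_ _)
  refine (lip_le_of_l1Dist_le (α := α.comp β) fun t u => ?_).trans_eq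
    (by push_cast; rw [add_assoc, one_add_one_eq_two])
  refine (hα _ _).trans ((mul_le_of_le_one_left (l1Dist_nonneg _ _) ?_).trans (hβ t u))
  refine pow_le_one₀ (by positivity) ?_
  rw [div_le_one (by positivity)]
  linarith

/-- With `m` the fineness of `σ`, what remains is the `m`-fold subdivision of `σ` plus correction
terms on the faces. Those involve only stages from the fineness of the face up to `m`, which are
already small. -/
theorem deform_adaptHom_mem (hS : ∀ A B : Set X, Small A → B ⊆ A → Small B)
    (h : ∀ (k : ℕ) (σ : Simplex X k), ∃ m, IsFine Small m σ) {k : ℕ} (z : Chain X k) :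
    deform (adaptHom Small) k z ∈ chainsIn {τ | Small (range τ)} := by
  refine map_mem_of_mem_chainsIn (S := univ) (fun σ _ => ?_) (by simp [chainsIn])
  cases k with
  | zero =>
    rw [deform_zero_apply, adaptHom_single, iterHom_apply]
    simp only [subdivHom_zero, LinearMap.zero_apply, Finset.sum_const_zero, map_zero, sub_zero]
    refine single_mem_chainsIn ?_ 1
    have := isFine_of_fineness_le h (le_refl (fineness Small σ)) univ fun t _ u _ => by
      rw [l1Dist_eq_zero_of_zero_dim]; positivity
    rwa [image_univ] at this
  | succ k =>
    rw [deform_succ_apply, adaptHom_single, bdry_iterHom]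
    have h1 : ∀ a b c d : Chain X (k + 1), a - (a - b - c) - d = b + (c - d) := by
      intros; abel
    rw [h1]
    refine Submodule.add_mem _ ?_ ?_
    · refine chainsIn_mono ?_ (subdiv_pow_mem _ σ)
      rintro _ ⟨α, hα, rfl⟩
      exact (isFine_of_fineness_le h le_rfl).small_range_comp hα
    · rw [bdry_single, map_sum, map_sum, ← Finset.sum_sub_distrib]
      refine Submodule.sum_mem _ fun i _ => ?_
      rw [map_smul, map_smul, ← smul_sub]
      refine Submodule.smul_mem _ _ ?_
      rw [adaptHom_single, iterHom_apply, iterHom_apply,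
        ← Finset.sum_Ico_eq_sub _ (fineness_face_le h σ i)]
      refine Submodule.sum_mem _ fun l hl => ?_
      rw [Finset.mem_Ico] at hl
      refine chainsIn_mono ?_ (subdivHom_subdiv_pow_mem l _)
      rintro _ ⟨α, hα, β, -, rfl⟩
      exact hS _ _ ((isFine_of_fineness_le h hl.1).small_range_comp hα)
        (range_comp_subset_range β ((face i σ).comp α))

end Small

/-! ### Local conical structures -/

/-- A choice of conical contractions to all points `x` of closed balls of radius `r x`, with uniform
metric distortion; the radii vary slowly and the balls are relatively compact. -/
structure LocalCones (X : Type*) [EMetricSpace X] (C : ℝ≥0) where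
  r : X → ℝ≥0∞
  κ : X → ℝ → X → X
  r_pos : ∀ x, 0 < r x
  r_le_one : ∀ x, r x ≤ 1
  r_le_add : ∀ x y, r x ≤ r y + edist x y
  conical : ∀ x, IsConical C x {y | edist y x ≤ r x} (κ x)
  compact : ∀ x, ∃ K, IsCompact K ∧ {y | edist y x ≤ r x} ⊆ K

namespace LocalCones

variable {X : Type*} [EMetricSpace X] {C : ℝ≥0} (𝓒 : LocalCones X C)

/-- Subsets that are small relative to the scale `r`. -/
def Small (s : ℝ≥0) (A : Set X) : Prop := ∀ y ∈ A, ∀ p ∈ A, edist p y ≤ s * 𝓒.r y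

theorem small_mono {s : ℝ≥0} {A B : Set X} (hA : 𝓒.Small s A) (hB : B ⊆ A) : 𝓒.Small s B :=
  fun y hy p hp => hA y (hB hy) p (hB hp)

theorem continuous_r : Continuous 𝓒.r :=
  continuous_of_le_add_edist 1 (by simp) fun x y => by
    rw [one_mul]
    exact 𝓒.r_le_add x y

theorem exists_isFine {s : ℝ≥0} (hs : 0 < s) (k : ℕ) (σ : Simplex X k) :
    ∃ m, IsFine (𝓒.Small s) m σ := by
  have : CompactSpace (stdDelta k) := by
    rw [← isCompact_iff_compactSpace]
    refine Metric.isCompact_of_isClosed_isBounded ?_ ?_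
    · have : stdDelta k = (⋂ i, {z | 0 ≤ z i}) ∩ {z | ∑ i, z i = 1} := by
        ext z; simp [stdDelta]
      rw [this]
      refine (isClosed_iInter fun i => ?_).inter ?_
      · exact isClosed_le continuous_const (by fun_prop)
      · exact isClosed_eq (by fun_prop) continuous_const
    · exact (Metric.isBounded_closedBall (x := (0 : EuclideanSpace ℝ (Fin (k + 1))))
        (r := 1)).subset fun z hz => by simpa using norm_le_one_of_mem_stdDelta ⟨z, hz⟩
  -- The scale has a positive minimum on the compact image; uniform continuity of `σ` then gives a
  -- mesh that works for it.
  obtain ⟨t₀, -, ht₀⟩ := isCompact_univ.exists_isMinOn (univ_nonempty (α := stdDelta k))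
    (𝓒.continuous_r.comp σ.continuous).continuousOn
  have hε : 0 < s * 𝓒.r (σ t₀) :=
    ENNReal.mul_pos (by exact_mod_cast hs.ne') (𝓒.r_pos _).ne'
  obtain ⟨δ, hδ, h⟩ := EMetric.uniformContinuous_iff.1
    (CompactSpace.uniformContinuous_of_continuous σ.continuous) _ hε
  obtain ⟨δ', hδ', hlt⟩ : ∃ δ' : ℝ, 0 < δ' ∧ ENNReal.ofReal δ' ≤ δ := by
    rcases eq_or_ne δ ⊤ with rfl | hδt
    · exact ⟨1, one_pos, le_top⟩
    · exact ⟨δ.toReal, ENNReal.toReal_pos hδ.ne' hδt, by rw [ENNReal.ofReal_toReal hδt]⟩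
  obtain ⟨m, hm⟩ := exists_pow_lt_of_lt_one (half_pos hδ')
    (show (k : ℝ) / (k + 1) < 1 by rw [div_lt_one (by positivity)]; linarith)
  refine ⟨m, fun A hA => ?_⟩
  rintro _ ⟨t, ht, rfl⟩ _ ⟨u, hu, rfl⟩
  have h1 : edist u t < δ := by
    refine lt_of_lt_of_le ?_ hlt
    rw [edist_dist, ENNReal.ofReal_lt_ofReal_iff hδ']
    linarith [hA u hu t ht, dist_le_l1Dist u t]
  refine (h h1).le.trans (mul_le_mul_right ?_ _)
  exact ht₀ (mem_univ t)

/-! ### Straightening small simplices -/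

/-- The straightening of a singular chain, by iterated cones. -/
def straight : ∀ k, Chain X k →ₗ[ℝ] Chain X k
  | 0 => LinearMap.id
  | k + 1 => linExt fun σ =>
      coneChain (𝓒.κ (σ default)) k (straight k (bdry X k (Finsupp.single σ 1)))

/-- The homotopy between the identity and straightening. -/
def straightHom : ∀ k, Chain X k →ₗ[ℝ] Chain X (k + 1)
  | 0 => 0
  | k + 1 => linExt fun σ => coneChain (𝓒.κ (σ default)) (k + 1)
      (Finsupp.single σ 1 - 𝓒.straight (k + 1) (Finsupp.single σ 1) -
        straightHom k (bdry X k (Finsupp.single σ 1)))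

theorem straight_succ_single {k : ℕ} (σ : Simplex X (k + 1)) :
    𝓒.straight (k + 1) (Finsupp.single σ 1) =
      coneChain (𝓒.κ (σ default)) k (𝓒.straight k (bdry X k (Finsupp.single σ 1))) :=
  linExt_single _ _

theorem straightHom_succ_single {k : ℕ} (σ : Simplex X (k + 1)) :
    𝓒.straightHom (k + 1) (Finsupp.single σ 1) = coneChain (𝓒.κ (σ default)) (k + 1)
      (Finsupp.single σ 1 - 𝓒.straight (k + 1) (Finsupp.single σ 1) -
        𝓒.straightHom k (bdry X k (Finsupp.single σ 1))) :=
  linExt_single _ _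

/-- The simplices close to all points of the set `A`, relative to the scale `r`. -/
def near (a : ℝ≥0) (A : Set X) (k : ℕ) : Set (Simplex X k) :=
  {τ | ∀ y ∈ A, ∀ p ∈ range τ, edist p y ≤ a * 𝓒.r y}

theorem near_mono {a b : ℝ≥0} (h : a ≤ b) (A : Set X) (k : ℕ) : 𝓒.near a A k ⊆ 𝓒.near b A k :=
  fun _ hτ y hy p hp => (hτ y hy p hp).trans (mul_le_mul_left (by exact_mod_cast h) _)

/-- Change of reference point: since `r` is 1-Lipschitz, it at most doubles between two points of a
small set. -/
theorem edist_le_of_small {s a : ℝ≥0} (hs : s ≤ 1) {A : Set X} (hA : 𝓒.Small s A) {y y' : X}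
    (hy : y ∈ A) (hy' : y' ∈ A) {p : X} (hp : edist p y' ≤ a * 𝓒.r y') :
    edist p y ≤ ((2 * a + s : ℝ≥0) : ℝ≥0∞) * 𝓒.r y := by
  have hs' : (s : ℝ≥0∞) ≤ 1 := by exact_mod_cast hs
  have h1 : 𝓒.r y' ≤ 2 * 𝓒.r y := by
    refine (𝓒.r_le_add y' y).trans ?_
    rw [two_mul]
    exact add_le_add_right ((hA y hy y' hy').trans (mul_le_of_le_one_left bot_le hs')) _
  calc edist p y ≤ edist p y' + edist y' y := edist_triangle _ _ _
    _ ≤ a * (2 * 𝓒.r y) + s * 𝓒.r y :=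
        add_le_add (hp.trans (mul_le_mul_right h1 _)) (hA y hy y' hy')
    _ = _ := by push_cast; ring

theorem near_of_near_subset {s a : ℝ≥0} (hs : s ≤ 1) {A B : Set X} (hA : 𝓒.Small s A)
    (hB : B ⊆ A) (hne : B.Nonempty) (k : ℕ) : 𝓒.near a B k ⊆ 𝓒.near (2 * a + s) A k := by
  obtain ⟨y', hy'⟩ := hne
  exact fun τ hτ y hy p hp => 𝓒.edist_le_of_small hs hA hy (hB hy') (hτ y' hy' p hp)

theorem range_subset_ball_of_near {a : ℝ≥0} (ha : a ≤ 1) {A : Set X} {y : X} (hy : y ∈ A) {k : ℕ}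
    {τ : Simplex X k} (hτ : τ ∈ 𝓒.near a A k) : range τ ⊆ {z | edist z y ≤ 𝓒.r y} :=
  fun p hp => (hτ y hy p hp).trans (mul_le_of_le_one_left bot_le (by exact_mod_cast ha))

/-- Relative to the apex the size grows by the factor `C`; the rest is the change of reference point
to other points of `A`. -/
theorem cone_mem_near {s a : ℝ≥0} (hs : s ≤ 1) (ha : a ≤ 1) {A : Set X} (hA : 𝓒.Small s A)
    {y₀ : X} (hy₀ : y₀ ∈ A) {k : ℕ} {τ : Simplex X k} (hτ : τ ∈ 𝓒.near a A k) :
    cone (𝓒.κ y₀) τ ∈ 𝓒.near (2 * (C * a) + s) A (k + 1) := by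
  have hr := 𝓒.range_subset_ball_of_near ha hy₀ hτ
  intro y hy p hp
  obtain ⟨z, hz, s', hs', rfl⟩ := range_cone_subset (𝓒.conical y₀) hr hp
  refine 𝓒.edist_le_of_small hs hA hy hy₀ (((𝓒.conical y₀).edist_center_apply_le hs'
    (hr hz)).trans ?_)
  rw [ENNReal.coe_mul, mul_assoc, edist_comm]
  exact mul_le_mul_right (hτ y₀ hy₀ z hz) _

end LocalCones

/-- Exhibits the deformed boundary as a boundary, hence as a reduced cycle, uniformly in the degree.
This is what makes it possible to cone it off. -/
theorem deform_bdry {X : Type*} [TopologicalSpace X] (H : ∀ k, Chain X k →ₗ[ℝ] Chain X (k + 1))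
    {k : ℕ} (z : Chain X (k + 1)) :
    deform H k (bdry X k z) = bdry X k (z - H k (bdry X k z)) := by
  rw [map_sub]
  cases k with
  | zero => rfl
  | succ k => rw [deform_succ_apply, bdry_bdry, map_zero, sub_zero]

/-! ### Inductive control of straightening -/

namespace LocalCones

variable {X : Type*} [EMetricSpace X] {C : ℝ≥0} (𝓒 : LocalCones X C)

/-- The properties of straightening in degree `k`: on simplices of relative size `s` with `M * s`
at most one, it is controlled in space and in Lipschitz constants. -/
def StraightControl (k : ℕ) (M : ℝ≥0) (B : ℝ≥0 → ℝ≥0) : Prop :=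
  ∀ s : ℝ≥0, M * s ≤ 1 → ∀ σ : Simplex X k, 𝓒.Small s (range σ) →
    𝓒.straight k (Finsupp.single σ 1) ∈
      chainsIn (𝓒.near (M * s) (range σ) k ∩ {τ | lip τ ≤ B 0}) ∧
    𝓒.straightHom k (Finsupp.single σ 1) ∈
      chainsIn (𝓒.near (M * s) (range σ) (k + 1) ∩ {τ | ∀ L : ℝ≥0, lip σ ≤ L → lip τ ≤ B L}) ∧
    deform 𝓒.straightHom k (Finsupp.single σ 1) = 𝓒.straight k (Finsupp.single σ 1)

/-- Straightened simplices are built from points by cones only, so their Lipschitz bound never sees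
`σ`. The homotopy cones off `σ` itself, so its bound depends on `lip σ`. The condition `M * s ≤ 1`
keeps every chain to be coned inside the ball where the contraction is defined. -/
theorem exists_straightControl (k : ℕ) : ∃ M B, 1 ≤ M ∧ 𝓒.StraightControl k M B := by
  induction k with
  | zero =>
    refine ⟨1, fun _ => 0, le_rfl, fun s _ σ hσ => ⟨?_, Submodule.zero_mem _, ?_⟩⟩
    · refine single_mem_chainsIn ?_ 1
      rw [one_mul]
      exact ⟨hσ, (lip_zero_dim σ).le⟩
    · rw [deform_zero_apply]
      change _ - bdry X 0 0 = _
      rw [map_zero, sub_zero]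
      rfl
  | succ k ih =>
    obtain ⟨M, B, hM, ih⟩ := ih
    -- The last summand covers the straightened faces seen from all of `σ`, the others the cone over
    -- them. The homotopy needs one further cone, so the same growth recurs in the next constant.
    let M₁ : ℝ≥0 := 2 * (C * (2 * M + 1)) + 1 + (2 * M + 1)
    let B₁ : ℝ≥0 := C * (2 + 2 * B 0)
    -- The sum `L + B₁ + B L` bounds the three terms `σ`, `T` and `u` that are coned for the
    -- homotopy; the final `B₁` makes the value at 0 bound the straightening as well.
    refine ⟨2 * (C * M₁) + 1 + M₁, fun L => C * (2 + 2 * (L + B₁ + B L)) + B₁,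
      le_add_right le_add_self, fun s hs σ hσ => ?_⟩
    have hM₁s : M₁ * s ≤ 1 := (mul_le_mul_left le_add_self _).trans hs
    have has : 2 * (M * s) + s ≤ M₁ * s := by
      rw [show 2 * (M * s) + s = (2 * M + 1) * s by ring]
      exact mul_le_mul_left le_add_self _
    have hcs : 2 * (C * (2 * (M * s) + s)) + s ≤ M₁ * s := by
      rw [show 2 * (C * (2 * (M * s) + s)) + s = (2 * (C * (2 * M + 1)) + 1) * s by ring]
      exact mul_le_mul_left le_self_add _
    have hs1 : s ≤ 1 := le_add_self.trans (has.trans hM₁s)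
    have hMs : M * s ≤ 1 :=
      ((le_mul_of_one_le_left bot_le one_le_two).trans le_self_add).trans (has.trans hM₁s)
    have hnear := fun i => 𝓒.near_of_near_subset (a := M * s) hs1 hσ (range_face_subset i σ)
      (range_nonempty _)
    have hface := fun i => ih s hMs (face i σ) (𝓒.small_mono hσ (range_face_subset i σ))
    have hy₀ : σ default ∈ range σ := ⟨_, rfl⟩
    set v := 𝓒.straight k (bdry X k (Finsupp.single σ 1)) with hv
    set u := 𝓒.straightHom k (bdry X k (Finsupp.single σ 1)) with hu
    have hvmem : v ∈ chainsIn (𝓒.near (2 * (M * s) + s) (range σ) k ∩ {τ | lip τ ≤ B 0}) := by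
      rw [hv, bdry_single, map_sum]
      refine Submodule.sum_mem _ fun i _ => ?_
      rw [map_smul]
      exact Submodule.smul_mem _ _
        (chainsIn_mono (inter_subset_inter_left _ (hnear i k)) (hface i).1)
    have humem : u ∈ chainsIn (𝓒.near (2 * (M * s) + s) (range σ) (k + 1) ∩
        {τ | ∀ L : ℝ≥0, lip σ ≤ L → lip τ ≤ B L}) := by
      rw [hu, bdry_single, map_sum]
      refine Submodule.sum_mem _ fun i _ => ?_
      rw [map_smul]
      refine Submodule.smul_mem _ _ (chainsIn_mono (inter_subset_inter (hnear i (k + 1)) ?_)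
        (hface i).2.1)
      exact fun τ hτ L hL => hτ L ((lip_face_le i σ).trans hL)
    have hvdef : v = bdry X k (Finsupp.single σ 1 - u) := by
      rw [hu, ← deform_bdry, hv, bdry_single, map_sum, map_sum]
      refine Finset.sum_congr rfl fun i _ => ?_
      rw [map_smul, map_smul, (hface i).2.2]
    have hT : 𝓒.straight (k + 1) (Finsupp.single σ 1) = coneChain (𝓒.κ (σ default)) k v :=
      𝓒.straight_succ_single σ
    set T := 𝓒.straight (k + 1) (Finsupp.single σ 1) with hTdef
    have hTmem : T ∈ chainsIn (𝓒.near (M₁ * s) (range σ) (k + 1) ∩ {τ | lip τ ≤ B₁}) := by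
      rw [hT]
      refine coneChain_mem_chainsIn ?_ hvmem
      rintro τ ⟨hτ, hτL⟩
      refine ⟨𝓒.near_mono hcs _ _ (𝓒.cone_mem_near hs1 (has.trans hM₁s) hσ hy₀ hτ), ?_⟩
      refine (lip_cone_le (𝓒.conical _)
        (𝓒.range_subset_ball_of_near (has.trans hM₁s) hy₀ hτ)).trans ?_
      simp only [B₁]
      push_cast
      gcongr
      exact hτL
    have hTbdry : bdry X k T = v := by
      rw [hT]
      refine bdry_coneChain (𝓒.conical _) (chainsIn_mono ?_ hvmem) ?_
      · exact fun τ hτ => 𝓒.range_subset_ball_of_near (has.trans hM₁s) hy₀ hτ.1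
      · rw [hvdef]
        exact bdry_mem_redCycles k _
    have hHdef : 𝓒.straightHom (k + 1) (Finsupp.single σ 1) =
      coneChain (𝓒.κ (σ default)) (k + 1) (Finsupp.single σ 1 - T - u) :=
        𝓒.straightHom_succ_single σ
    have hwmem : Finsupp.single σ 1 - T - u ∈ chainsIn (𝓒.near (M₁ * s) (range σ) (k + 1) ∩
        {τ | ∀ L : ℝ≥0, lip σ ≤ L → lip τ ≤ (L + B₁ + B L : ℝ≥0)}) := by
      refine Submodule.sub_mem _ (Submodule.sub_mem _ ?_ ?_) ?_
      · refine single_mem_chainsIn ?_ 1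
        refine ⟨?_, fun L hL => hL.trans ?_⟩
        · refine 𝓒.near_mono (?_ : s ≤ _) _ _ hσ
          exact le_add_self.trans has
        · exact_mod_cast le_add_right le_self_add
      · refine chainsIn_mono (inter_subset_inter_right _ ?_) hTmem
        refine fun τ hτ L hL => le_trans hτ ?_
        exact_mod_cast le_add_right le_add_self
      · refine chainsIn_mono (inter_subset_inter (𝓒.near_mono has _ _) ?_) humem
        refine fun τ hτ L hL => le_trans (hτ L hL) ?_
        exact_mod_cast le_add_self
    refine ⟨chainsIn_mono (inter_subset_inter ?_ ?_) hTmem, ?_, ?_⟩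
    · exact 𝓒.near_mono (mul_le_mul_left le_add_self _) _ _
    · intro τ hτ
      have hτ' : lip τ ≤ B₁ := hτ
      exact hτ'.trans (by exact_mod_cast le_add_self)
    · rw [hHdef]
      refine coneChain_mem_chainsIn ?_ hwmem
      rintro τ ⟨hτ, hτL⟩
      refine ⟨𝓒.near_mono ?_ _ _ (𝓒.cone_mem_near hs1 hM₁s hσ hy₀ hτ), fun L hL => ?_⟩
      · rw [show 2 * (C * (M₁ * s)) + s = (2 * (C * M₁) + 1) * s by ring]
        exact mul_le_mul_left le_self_add _
      · refine (lip_cone_le (𝓒.conical _)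
          (𝓒.range_subset_ball_of_near hM₁s hy₀ hτ)).trans ?_
        rw [ENNReal.coe_add, ENNReal.coe_mul, ENNReal.coe_add 2, ENNReal.coe_mul 2]
        refine le_add_right ?_
        rw [ENNReal.coe_ofNat]
        gcongr
        exact hτL L hL
    · have hH : bdry X (k + 1) (𝓒.straightHom (k + 1) (Finsupp.single σ 1)) =
          Finsupp.single σ 1 - T - u := by
        rw [hHdef]
        refine bdry_coneChain (𝓒.conical _) (chainsIn_mono ?_ hwmem) ?_
        · exact fun τ hτ => 𝓒.range_subset_ball_of_near hM₁s hy₀ hτ.1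
        · change bdry X k _ = 0
          rw [sub_right_comm, map_sub, hTbdry, hvdef, sub_self]
      rw [deform_succ_apply, hH]
      abel

/-! ### The total homotopy -/

/-- The composite of adapted subdivision and straightening, as a homotopy. -/
def totalHom (s : ℝ≥0) (k : ℕ) : Chain X k →ₗ[ℝ] Chain X (k + 1) :=
  adaptHom (𝓒.Small s) k + 𝓒.straightHom k ∘ₗ deform (adaptHom (𝓒.Small s)) k

theorem totalHom_apply (s : ℝ≥0) {k : ℕ} (z : Chain X k) : 𝓒.totalHom s k z =
    adaptHom (𝓒.Small s) k z + 𝓒.straightHom k (deform (adaptHom (𝓒.Small s)) k z) := rfl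

/-- Concatenation of homotopies. It works because the first deformation is a chain map
(`bdry_deform`). -/
theorem deform_totalHom (s : ℝ≥0) {k : ℕ} (z : Chain X k) : deform (𝓒.totalHom s) k z =
    deform 𝓒.straightHom k (deform (adaptHom (𝓒.Small s)) k z) := by
  cases k with
  | zero =>
    rw [deform_zero_apply, deform_zero_apply, totalHom_apply, map_add, deform_zero_apply]
    abel
  | succ k =>
    rw [deform_succ_apply, deform_succ_apply 𝓒.straightHom, totalHom_apply, totalHom_apply,
      map_add, bdry_deform, deform_succ_apply]
    abel

theorem deform_adaptHom_mem_of_lip_le {s : ℝ≥0} (hs : 0 < s) {k : ℕ} (σ : Simplex X k) :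
    deform (adaptHom (𝓒.Small s)) k (Finsupp.single σ 1) ∈ chainsIn
      {τ | 𝓒.Small s (range τ) ∧ range τ ⊆ range σ ∧ lip τ ≤ lip σ * (k + 2)} := by
  have h1 := deform_adaptHom_mem (fun A B hA hB => 𝓒.small_mono hA hB)
    (𝓒.exists_isFine hs) (Finsupp.single σ 1)
  refine (fun h2 => ?_ : deform (adaptHom (𝓒.Small s)) k (Finsupp.single σ 1) ∈ chainsIn
      {τ | range τ ⊆ range σ ∧ lip τ ≤ lip σ * (k + 2)} → _) ?_
  · rw [chainsIn, Finsupp.mem_supported] at h1 h2 ⊢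
    exact fun τ hτ => ⟨h1 hτ, h2 hτ⟩
  have hle : lip σ ≤ lip σ * (k + 2) := le_mul_of_one_le_right bot_le
    (le_add_left one_le_two)
  have hmem : σ ∈ {τ : Simplex X k | range τ ⊆ range σ ∧ lip τ ≤ lip σ * (k + 2)} :=
    ⟨subset_rfl, hle⟩
  cases k with
  | zero =>
    rw [deform_zero_apply]
    refine Submodule.sub_mem _ (single_mem_chainsIn hmem 1)
      (bdry_mem_chainsIn ?_ (adaptHom_mem σ))
    exact fun τ hτ i => ⟨(range_face_subset i τ).trans hτ.1, (lip_face_le i τ).trans hτ.2⟩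
  | succ k =>
    rw [deform_succ_apply]
    refine Submodule.sub_mem _ (Submodule.sub_mem _ (single_mem_chainsIn hmem 1)
      (bdry_mem_chainsIn ?_ (adaptHom_mem σ))) ?_
    · exact fun τ hτ i => ⟨(range_face_subset i τ).trans hτ.1, (lip_face_le i τ).trans hτ.2⟩
    · rw [bdry_single, map_sum]
      refine Submodule.sum_mem _ fun i _ => ?_
      rw [map_smul]
      refine Submodule.smul_mem _ _ (chainsIn_mono ?_ (adaptHom_mem _))
      rintro τ ⟨h3, h4⟩
      refine ⟨h3.trans (range_face_subset i σ), h4.trans (mul_le_mul' (lip_face_le i σ) ?_)⟩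
      push_cast
      gcongr
      exact le_self_add

/-- Points of a compact set are far, relative to the scale, from the complement of another one. -/
theorem exists_compact_nhd {a : ℝ≥0} (ha : a ≤ 1 / 8) {K : Set X} (hK : IsCompact K) :
    ∃ K', IsCompact K' ∧ K ⊆ K' ∧ ∀ y p, p ∈ K → edist p y ≤ a * 𝓒.r y → y ∈ K' := by
  have hq : ∀ x, 0 < 𝓒.r x / 4 := fun x => ENNReal.div_pos (𝓒.r_pos x).ne' (by simp)
  obtain ⟨F, hF⟩ := hK.elim_nhds_subcover (fun x => {z | edist z x < 𝓒.r x / 4})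
    fun x _ => Metric.eball_mem_nhds x (hq x)
  choose Q hQ hQs using 𝓒.compact
  -- With `d = edist y x` and `r y ≤ r x + d`, the triangle inequality gives `d ≤ (r x + d) / 8 + r
  -- x / 4`, hence `d ≤ (3/7) * r x`.
  have key : ∀ y p x : X, edist p y ≤ a * 𝓒.r y → edist p x < 𝓒.r x / 4 → edist y x ≤ 𝓒.r x := by
    intro y p x hy hx
    have hne : ∀ z, 𝓒.r z ≠ ⊤ := fun z => ((𝓒.r_le_one z).trans_lt ENNReal.one_lt_top).ne
    have h1 := 𝓒.r_le_add y x
    have h2 := edist_triangle y p x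
    rw [edist_comm y p] at h2
    have hpx : edist p x ≠ ⊤ := (hx.trans_le le_top).ne
    have hpy : edist p y ≠ ⊤ :=
      (hy.trans_lt (ENNReal.mul_lt_top ENNReal.coe_lt_top (hne y).lt_top)).ne
    have hyx : edist y x ≠ ⊤ := (h2.trans_lt (ENNReal.add_lt_top.2 ⟨hpy.lt_top, hpx.lt_top⟩)).ne
    have ha' : (a : ℝ) ≤ 1 / 8 := by exact_mod_cast ha
    have hy' := ENNReal.toReal_mono (ENNReal.mul_ne_top ENNReal.coe_ne_top (hne y)) hy
    have hx' := ENNReal.toReal_mono (ENNReal.div_ne_top (hne x) (by norm_num)) hx.le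
    have h1' := ENNReal.toReal_mono (ENNReal.add_ne_top.2 ⟨hne x, hyx⟩) h1
    have h2' := ENNReal.toReal_mono (ENNReal.add_ne_top.2 ⟨hpy, hpx⟩) h2
    rw [ENNReal.toReal_mul, ENNReal.coe_toReal] at hy'
    rw [ENNReal.toReal_div, ENNReal.toReal_ofNat] at hx'
    rw [ENNReal.toReal_add (hne x) hyx] at h1'
    rw [ENNReal.toReal_add hpy hpx] at h2'
    rw [← ENNReal.toReal_le_toReal hyx (hne x)]
    have h0 : 0 ≤ (𝓒.r y).toReal := ENNReal.toReal_nonneg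
    nlinarith
  refine ⟨⋃ x ∈ F, Q x, F.isCompact_biUnion fun x _ => hQ x, fun p hp => ?_, fun y p hp hy => ?_⟩
  · obtain ⟨x, hxF, hx⟩ := mem_iUnion₂.1 (hF.2 hp)
    exact mem_biUnion hxF (hQs x (key p p x (by simp) hx))
  · obtain ⟨x, hxF, hx⟩ := mem_iUnion₂.1 (hF.2 hp)
    exact mem_biUnion hxF (hQs x (key y p x hy hx))

/-- Up to degree `N`, the singular chain complex can be deformed to a complex of uniformly Lipschitz
chains by a homotopy that is controlled in space and in Lipschitz constants. -/
theorem exists_deformation (𝓒 : LocalCones X C) (N : ℕ) :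
    ∃ H : ∀ k, Chain X k →ₗ[ℝ] Chain X (k + 1),
    (∀ k ≤ N, ∃ B : ℝ≥0, ∀ σ : Simplex X k,
      deform H k (Finsupp.single σ 1) ∈ chainsIn {τ | lip τ ≤ B}) ∧
    (∀ k ≤ N, ∀ L : ℝ≥0, ∃ B : ℝ≥0, ∀ σ : Simplex X k, lip σ ≤ L →
      H k (Finsupp.single σ 1) ∈ chainsIn {τ | lip τ ≤ B}) ∧
    (∀ k ≤ N, ∀ K : Set X, IsCompact K → ∃ K', IsCompact K' ∧ K ⊆ K' ∧
      ∀ σ : Simplex X k, range σ ⊆ K'ᶜ →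
        H k (Finsupp.single σ 1) ∈ chainsIn {τ | range τ ⊆ Kᶜ}) := by
  choose M B hM hB using 𝓒.exists_straightControl
  -- One `s` has to serve all degrees at once, while `M k` may grow with `k`; hence the truncation
  -- at `N`. The bound `1 / 8` is the one in `exists_compact_nhd`.
  obtain ⟨s, hs, hsM⟩ : ∃ s : ℝ≥0, 0 < s ∧ ∀ k ≤ N, M k * s ≤ 1 / 8 := by
    let Q : ℝ≥0 := ∑ k ∈ Finset.range (N + 1), M k
    have hQ : ∀ k ≤ N, M k ≤ Q := fun k hk =>
      Finset.single_le_sum (fun _ _ => bot_le) (Finset.mem_range.2 (by omega))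
    have hQ0 : 0 < Q := (zero_lt_one.trans_le (hM 0)).trans_le (hQ 0 (Nat.zero_le _))
    refine ⟨1 / 8 / Q, by positivity, fun k hk => ?_⟩
    refine (mul_le_mul_left (hQ k hk) _).trans_eq ?_
    rw [mul_div_cancel₀ _ hQ0.ne']
  have hsM1 : ∀ k ≤ N, M k * s ≤ 1 := fun k hk => (hsM k hk).trans (by
    rw [div_le_one (by norm_num)]; norm_num)
  refine ⟨𝓒.totalHom s, fun k hk => ⟨B k 0, fun σ => ?_⟩, fun k hk L => ?_, fun k hk K hK => ?_⟩
  · rw [deform_totalHom]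
    refine map_mem_of_mem_chainsIn ?_ (𝓒.deform_adaptHom_mem_of_lip_le hs σ)
    rintro τ ⟨hτ, -⟩
    have := hB k s (hsM1 k hk) τ hτ
    rw [this.2.2]
    exact chainsIn_mono inter_subset_right this.1
  · refine ⟨L * (k + 2) + B k (L * (k + 2)), fun σ hσ => ?_⟩
    have hσ' : lip σ * (k + 2) ≤ (L * (k + 2) : ℝ≥0) := by
      push_cast
      exact mul_le_mul_left hσ _
    rw [totalHom_apply]
    refine Submodule.add_mem _ (chainsIn_mono ?_ (adaptHom_mem σ))
      (map_mem_of_mem_chainsIn ?_ (𝓒.deform_adaptHom_mem_of_lip_le hs σ))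
    · exact fun τ hτ => (hτ.2.trans hσ').trans (by exact_mod_cast le_self_add)
    · rintro τ ⟨hτ, -, hτL⟩
      refine chainsIn_mono ?_ (hB k s (hsM1 k hk) τ hτ).2.1
      exact fun ρ hρ => (hρ.2 _ (hτL.trans hσ')).trans (by exact_mod_cast le_add_self)
  · obtain ⟨K', hK', hKK', h⟩ := 𝓒.exists_compact_nhd (hsM k hk) hK
    refine ⟨K', hK', hKK', fun σ hσ => ?_⟩
    rw [totalHom_apply]
    refine Submodule.add_mem _ (chainsIn_mono ?_ (adaptHom_mem σ))
      (map_mem_of_mem_chainsIn ?_ (𝓒.deform_adaptHom_mem_of_lip_le hs σ))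
    · exact fun τ hτ => hτ.1.trans (hσ.trans (compl_subset_compl.2 hKK'))
    · rintro τ ⟨hτ, hτσ, -⟩
      refine chainsIn_mono ?_ (hB k s (hsM1 k hk) τ hτ).2.1
      -- If a resulting simplex met `K` at `p`, every point of the small simplex `τ` would be close
      -- to `p` and so lie in `K'`; one point of `τ` gives the contradiction.
      rintro ρ ⟨hρ, -⟩ p hp hpK
      exact hσ (hτσ ⟨default, rfl⟩) (h _ p hpK (hρ _ ⟨default, rfl⟩ p hp))

end LocalCones

/-! ### The isomorphism in cohomology induced by a controlled deformation -/

section Algebra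

variable {X : Type*} [EMetricSpace X]

/-- A homotopy on singular chains, up to degree `N`, from the identity to a chain map with values in
uniformly Lipschitz chains; the homotopy is controlled in space and in Lipschitz constants. -/
structure IsLipDeformation (H : ∀ k, Chain X k →ₗ[ℝ] Chain X (k + 1)) (N : ℕ) : Prop where
  lip_deform : ∀ k ≤ N, ∃ B : ℝ≥0, ∀ σ : Simplex X k,
    deform H k (Finsupp.single σ 1) ∈ chainsIn {τ | lip τ ≤ B}
  lip_hom : ∀ k ≤ N, ∀ L : ℝ≥0, ∃ B : ℝ≥0, ∀ σ : Simplex X k, lip σ ≤ L →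
    H k (Finsupp.single σ 1) ∈ chainsIn {τ | lip τ ≤ B}
  local_hom : ∀ k ≤ N, ∀ K : Set X, IsCompact K → ∃ K', IsCompact K' ∧ K ⊆ K' ∧
    ∀ σ : Simplex X k, range σ ⊆ K'ᶜ →
      H k (Finsupp.single σ 1) ∈ chainsIn {τ | range τ ⊆ Kᶜ}

/-- Extending `f` linearly to all chains reduces the claim to evaluation on basis simplices. -/
theorem lipDual_eq_zero {k : ℕ} {S : Set (Simplex X k)} (f : Module.Dual ℝ (lipChain X k))
    (hf : ∀ σ ∈ S, ∀ hσ : lip σ < ⊤, f (lipSingle σ hσ) = 0) (z : lipChain X k)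
    (hz : z.1 ∈ chainsIn S) : f z = 0 := by
  obtain ⟨g, hg⟩ := LinearMap.exists_extend f
  have hgz : ∀ z : lipChain X k, g z.1 = f z := fun z => LinearMap.congr_fun hg z
  have hz' : z.1 ∈ chainsIn (S ∩ {σ | lip σ < ⊤}) := by
    have h1 : z.1 ∈ chainsIn {σ : Simplex X k | lip σ < ⊤} := z.2
    rw [Finsupp.mem_supported] at hz h1 ⊢
    exact subset_inter hz h1
  rw [← hgz]
  have := map_mem_of_mem_chainsIn (f := g) (N := ⊥) (fun σ hσ => ?_) hz'
  · simpa using this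
  · rw [Submodule.mem_bot]
    exact (hgz (lipSingle σ hσ.2)).trans (hf σ hσ.1 hσ.2)

theorem chainsIn_lip_le_lipChain {k : ℕ} (B : ℝ≥0) :
    chainsIn {τ : Simplex X k | lip τ ≤ B} ≤ lipChain X k :=
  chainsIn_mono fun _ hτ => lt_of_le_of_lt hτ ENNReal.coe_lt_top

namespace IsLipDeformation

variable {H : ∀ k, Chain X k →ₗ[ℝ] Chain X (k + 1)} {N : ℕ}

theorem local_deform (h : IsLipDeformation H N) {k : ℕ} (hk : k ≤ N) {K : Set X} (hK : IsCompact K) :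
    ∃ K', IsCompact K' ∧
    ∀ σ : Simplex X k, range σ ⊆ K'ᶜ →
      deform H k (Finsupp.single σ 1) ∈ chainsIn {τ | range τ ⊆ Kᶜ} := by
  obtain ⟨K₁, hK₁, hKK₁, h₁⟩ := h.local_hom k hk K hK
  have hb : ∀ σ : Simplex X k, range σ ⊆ K₁ᶜ →
      bdry X k (H k (Finsupp.single σ 1)) ∈ chainsIn {τ | range τ ⊆ Kᶜ} := fun σ hσ =>
    bdry_mem_chainsIn (fun τ hτ i => (range_face_subset i τ).trans hτ) (h₁ σ hσ)
  cases k with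
  | zero =>
    refine ⟨K₁, hK₁, fun σ hσ => ?_⟩
    rw [deform_zero_apply]
    exact Submodule.sub_mem _
      (single_mem_chainsIn (hσ.trans (compl_subset_compl.2 hKK₁)) 1) (hb σ hσ)
  | succ k =>
    obtain ⟨K₂, hK₂, hKK₂, h₂⟩ := h.local_hom k (by omega) K hK
    refine ⟨K₁ ∪ K₂, hK₁.union hK₂, fun σ hσ => ?_⟩
    rw [compl_union, subset_inter_iff] at hσ
    rw [deform_succ_apply]
    refine Submodule.sub_mem _ (Submodule.sub_mem _
      (single_mem_chainsIn (hσ.1.trans (compl_subset_compl.2 hKK₁)) 1) (hb σ hσ.1)) ?_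
    rw [bdry_single, map_sum]
    refine Submodule.sum_mem _ fun i _ => ?_
    rw [map_smul]
    exact Submodule.smul_mem _ _ (h₂ _ ((range_face_subset i σ).trans hσ.2))

theorem deform_mem_lipChain (h : IsLipDeformation H N) {k : ℕ} (hk : k ≤ N) (z : Chain X k) :
    deform H k z ∈ lipChain X k := by
  obtain ⟨B, hB⟩ := h.lip_deform k hk
  exact map_mem_of_mem_chainsIn (S := univ)
    (fun σ _ => chainsIn_lip_le_lipChain B (hB σ)) (by simp [chainsIn])

theorem hom_mem_lipChain (h : IsLipDeformation H N) {k : ℕ} (hk : k ≤ N) {z : Chain X k}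
    (hz : z ∈ lipChain X k) :
    H k z ∈ lipChain X (k + 1) := by
  refine map_mem_of_mem_chainsIn (fun σ hσ => ?_) hz
  obtain ⟨B, hB⟩ := h.lip_hom k hk (lip σ).toNNReal
  have hσ' : lip σ < ⊤ := hσ
  exact chainsIn_lip_le_lipChain B (hB σ (by rw [ENNReal.coe_toNNReal hσ'.ne]))

/-- The cochain map induced by the deformation. -/
def pullDeform (h : IsLipDeformation H N) {k : ℕ} (hk : k ≤ N) :
    cslipCochain X k →ₗ[ℝ] csCochain X k :=
  (LinearMap.codRestrict (lipChain X k) (deform H k)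
    (h.deform_mem_lipChain hk)).dualMap.restrict fun f hf => by
    obtain ⟨B, hB⟩ := h.lip_deform k hk
    -- The heart of the comparison: a single Lipschitz level matters, because `deform H` is
    -- uniformly Lipschitz. The `+ 1` turns `≤ B` into the strict inequality in the support
    -- condition.
    obtain ⟨K, hK, hf⟩ := hf (B + 1) (by positivity)
    obtain ⟨K', hK', hT⟩ := h.local_deform hk hK
    refine ⟨K', hK', fun σ hσ => lipDual_eq_zero (S := {τ | lip τ ≤ B} ∩ {τ | range τ ⊆ Kᶜ}) f
      (fun τ hτ _ => hf τ ?_ hτ.2) _ ?_⟩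
    · have hτ' : lip τ ≤ B := hτ.1
      refine hτ'.trans_lt ?_
      rw [← ENNReal.ofReal_coe_nnreal, ENNReal.ofReal_lt_ofReal_iff (by positivity)]
      linarith
    · have h1 := hB σ
      have h2 := hT σ hσ
      rw [chainsIn, Finsupp.mem_supported] at h1 h2 ⊢
      exact subset_inter h1 h2

/-- The homotopy on cochains with compact support. -/
def pullHom (h : IsLipDeformation H N) {k : ℕ} (hk : k ≤ N) :
    csCochain X (k + 1) →ₗ[ℝ] csCochain X k :=
  (H k).dualMap.restrict fun f hf => by
    obtain ⟨K, hK, hf⟩ := hf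
    obtain ⟨K', hK', -, hH⟩ := h.local_hom k hk K hK
    refine ⟨K', hK', fun σ hσ => ?_⟩
    have := map_mem_of_mem_chainsIn (f := f) (N := ⊥)
      (fun τ hτ => (Submodule.mem_bot ℝ).2 (hf τ hτ)) (hH σ hσ)
    simpa using this

/-- The homotopy on cochains with Lipschitz compact support. -/
def pullLipHom (h : IsLipDeformation H N) {k : ℕ} (hk : k ≤ N) :
    cslipCochain X (k + 1) →ₗ[ℝ] cslipCochain X k :=
  ((H k).restrict fun _ hz => h.hom_mem_lipChain hk hz :
    lipChain X k →ₗ[ℝ] lipChain X (k + 1)).dualMap.restrict fun f hf L hL => by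
    obtain ⟨B, hB⟩ := h.lip_hom k hk L.toNNReal
    obtain ⟨K, hK, hf⟩ := hf (B + 1) (by positivity)
    obtain ⟨K', hK', -, hH⟩ := h.local_hom k hk K hK
    refine ⟨K', hK', fun σ hσ hσK => lipDual_eq_zero
      (S := {τ | lip τ ≤ B} ∩ {τ | range τ ⊆ Kᶜ}) f (fun τ hτ _ => hf τ ?_ hτ.2) _ ?_⟩
    · have hτ' : lip τ ≤ B := hτ.1
      refine hτ'.trans_lt ?_
      rw [← ENNReal.ofReal_coe_nnreal, ENNReal.ofReal_lt_ofReal_iff (by positivity)]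
      linarith
    · have h1 := hB σ hσ.le
      have h2 := hH σ hσK
      rw [chainsIn, Finsupp.mem_supported] at h1 h2 ⊢
      exact subset_inter h1 h2

/-- The cocycle condition is evaluated on deformed chains one degree higher, which must be Lipschitz
too; hence control up to `k + 1`. -/
theorem csCobdry_pullDeform_eq_zero (h : IsLipDeformation H N) {k : ℕ} (hk : k + 1 ≤ N)
    {f : cslipCochain X k} (hf : cslipCobdry X k f = 0) :
    csCobdry X k (h.pullDeform (by omega : k ≤ N) f) = 0 := by
  refine Subtype.ext (LinearMap.ext fun z => ?_)
  have h1 := LinearMap.congr_fun (congrArg Subtype.val hf)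
    ⟨deform H (k + 1) z, h.deform_mem_lipChain hk z⟩
  refine Eq.trans ?_ h1
  refine congrArg f.1 (Subtype.ext ?_)
  exact (bdry_deform H z).symm

theorem restrictCochain_pullDeform_zero (h : IsLipDeformation H N)
    {f : cslipCochain X 0} (hf : cslipCobdry X 0 f = 0) :
    restrictCochain X 0 (h.pullDeform (Nat.zero_le N) f) = f := by
  refine Subtype.ext (LinearMap.ext fun z => ?_)
  have h1 : f.1 (lipBdry X 0 ⟨H 0 z.1, h.hom_mem_lipChain (Nat.zero_le N) z.2⟩) = 0 :=
    LinearMap.congr_fun (congrArg Subtype.val hf) _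
  rw [← sub_eq_zero, ← neg_eq_zero, ← h1, neg_sub, eq_comm]
  refine (congrArg f.1 (Subtype.ext ?_)).trans (map_sub f.1 z _)
  exact (sub_sub_cancel z.1 _).symm

/-- Surjectivity on cohomology: `f ∘ T = f - f ∘ ∂H - f ∘ H∂`, and the middle term vanishes for a
cocycle. -/
theorem restrictCochain_pullDeform_succ (h : IsLipDeformation H N) {k : ℕ} (hk : k + 1 ≤ N)
    {f : cslipCochain X (k + 1)} (hf : cslipCobdry X (k + 1) f = 0) :
    restrictCochain X (k + 1) (h.pullDeform hk f) +
      cslipCobdry X k (h.pullLipHom (by omega : k ≤ N) f) = f := by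
  refine Subtype.ext (LinearMap.ext fun z => ?_)
  have h1 : f.1 (lipBdry X (k + 1) ⟨H (k + 1) z.1, h.hom_mem_lipChain hk z.2⟩) = 0 :=
    LinearMap.congr_fun (congrArg Subtype.val hf) _
  rw [← add_zero (f.1 z), ← neg_zero, ← h1, ← map_neg]
  refine (map_add f.1 _ _).symm.trans (Eq.trans ?_ (map_add f.1 z _))
  refine congrArg f.1 (Subtype.ext ?_)
  change deform H (k + 1) z.1 + H k (bdry X k z.1) = z.1 + -bdry X (k + 1) (H (k + 1) z.1)
  rw [deform_succ_apply]
  abel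

theorem eq_zero_of_restrictCochain_eq_zero (h : IsLipDeformation H N)
    {g : csCochain X 0} (hg : csCobdry X 0 g = 0) (hr : restrictCochain X 0 g = 0) : g = 0 := by
  refine Subtype.ext (LinearMap.ext fun z => ?_)
  have h1 : g.1 (bdry X 0 (H 0 z)) = 0 := LinearMap.congr_fun (congrArg Subtype.val hg) _
  have h2 : g.1 (deform H 0 z) = 0 := LinearMap.congr_fun (congrArg Subtype.val hr)
    ⟨deform H 0 z, h.deform_mem_lipChain (Nat.zero_le N) z⟩
  rwa [deform_zero_apply, map_sub, h1, sub_zero] at h2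

/-- Injectivity on cohomology: for a cocycle, `g = g ∘ T + g ∘ H∂`, and `T` has Lipschitz values, on
which `g` is the coboundary of `f`. -/
theorem eq_csCobdry_of_restrictCochain_eq (h : IsLipDeformation H N) {k : ℕ} (hk : k + 1 ≤ N)
    {g : csCochain X (k + 1)} (hg : csCobdry X (k + 1) g = 0) {f : cslipCochain X k}
    (hf : restrictCochain X (k + 1) g = cslipCobdry X k f) :
    g = csCobdry X k (h.pullHom (by omega : k ≤ N) g + h.pullDeform (by omega : k ≤ N) f) := by
  refine Subtype.ext (LinearMap.ext fun z => ?_)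
  have h1 : g.1 (bdry X (k + 1) (H (k + 1) z)) = 0 :=
    LinearMap.congr_fun (congrArg Subtype.val hg) _
  have h2 : g.1 (deform H (k + 1) z) =
      f.1 (lipBdry X k ⟨deform H (k + 1) z, h.deform_mem_lipChain hk z⟩) :=
    LinearMap.congr_fun (congrArg Subtype.val hf)
      ⟨deform H (k + 1) z, h.deform_mem_lipChain hk z⟩
  have h3 : lipBdry X k ⟨deform H (k + 1) z, h.deform_mem_lipChain hk z⟩ =
      ⟨deform H k (bdry X k z), h.deform_mem_lipChain (by omega) _⟩ :=
    Subtype.ext (bdry_deform H z)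
  rw [h3, deform_succ_apply, map_sub, map_sub, h1, sub_zero] at h2
  change g.1 z = g.1 (H k (bdry X k z)) + f.1 ⟨deform H k (bdry X k z), _⟩
  rw [← h2]
  abel

end IsLipDeformation

/-! ### Passage to the homology of the cochain complexes -/

theorem prev_up_nat_succ (k : ℕ) : (ComplexShape.up ℕ).prev (k + 1) = k :=
  (ComplexShape.up ℕ).prev_eq' rfl

theorem next_up_nat (k : ℕ) : (ComplexShape.up ℕ).next k = k + 1 :=
  (ComplexShape.up ℕ).next_eq' rfl

theorem csComplex_d (k : ℕ) :
    (csComplex X).d k (k + 1) = ModuleCat.ofHom (csCobdry X k) := by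
  simp only [csComplex, CochainComplex.of_d]

theorem cslipComplex_d (k : ℕ) :
    (cslipComplex X).d k (k + 1) = ModuleCat.ofHom (cslipCobdry X k) := by
  simp only [cslipComplex, CochainComplex.of_d]

open CategoryTheory in
theorem IsLipDeformation.mono_homologyMap {H : ∀ k, Chain X k →ₗ[ℝ] Chain X (k + 1)} {k : ℕ}
    (h : IsLipDeformation H (k + 1)) :
    Mono (HomologicalComplex.homologyMap (restriction X) k) := by
  cases k with
  | zero =>
    rw [HomologicalComplex.mono_homologyMap_iff_up_to_refinements _ 0 0 1 (by simp) (by simp)]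
    intro A x hx y hy
    refine ⟨A, 𝟙 A, inferInstance, 0, ?_⟩
    rw [(cslipComplex X).shape 0 0 (by simp), Limits.comp_zero] at hy
    rw [csComplex_d] at hx
    rw [Limits.zero_comp, Category.id_comp]
    ext a
    refine h.eq_zero_of_restrictCochain_eq_zero (g := x.hom a) ?_ ?_
    · exact LinearMap.congr_fun (congrArg ModuleCat.Hom.hom hx) a
    · exact LinearMap.congr_fun (congrArg ModuleCat.Hom.hom hy) a
  | succ k =>
    rw [HomologicalComplex.mono_homologyMap_iff_up_to_refinements _ k (k + 1) (k + 2)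
      (prev_up_nat_succ k) (next_up_nat _)]
    intro A x hx y hy
    rw [csComplex_d] at hx
    rw [cslipComplex_d] at hy
    refine ⟨A, 𝟙 A, inferInstance, x ≫ ModuleCat.ofHom (h.pullHom (by omega : k ≤ k + 2)) +
      y ≫ ModuleCat.ofHom (h.pullDeform (by omega : k ≤ k + 2)), ?_⟩
    rw [csComplex_d, Category.id_comp]
    ext a
    refine h.eq_csCobdry_of_restrictCochain_eq (by omega) (g := x.hom a) (f := y.hom a) ?_ ?_
    · exact LinearMap.congr_fun (congrArg ModuleCat.Hom.hom hx) a
    · exact LinearMap.congr_fun (congrArg ModuleCat.Hom.hom hy) a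

open CategoryTheory in
theorem IsLipDeformation.epi_homologyMap {H : ∀ k, Chain X k →ₗ[ℝ] Chain X (k + 1)} {k : ℕ}
    (h : IsLipDeformation H (k + 1)) :
    Epi (HomologicalComplex.homologyMap (restriction X) k) := by
  cases k with
  | zero =>
    rw [HomologicalComplex.epi_homologyMap_iff_up_to_refinements _ 0 0 1 (by simp) (by simp)]
    intro A y hy
    rw [cslipComplex_d] at hy
    have hy' : ∀ a, cslipCobdry X 0 (y.hom a) = 0 := fun a =>
      LinearMap.congr_fun (congrArg ModuleCat.Hom.hom hy) a
    refine ⟨A, 𝟙 A, inferInstance, y ≫ ModuleCat.ofHom (h.pullDeform (Nat.zero_le 1)), ?_, 0, ?_⟩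
    · rw [csComplex_d]
      ext a
      exact h.csCobdry_pullDeform_eq_zero le_rfl (hy' a)
    · rw [Limits.zero_comp, add_zero, Category.id_comp]
      ext a
      exact (h.restrictCochain_pullDeform_zero (hy' a)).symm
  | succ k =>
    rw [HomologicalComplex.epi_homologyMap_iff_up_to_refinements _ k (k + 1) (k + 2)
      (prev_up_nat_succ k) (next_up_nat _)]
    intro A y hy
    rw [cslipComplex_d] at hy
    have hy' : ∀ a, cslipCobdry X (k + 1) (y.hom a) = 0 := fun a =>
      LinearMap.congr_fun (congrArg ModuleCat.Hom.hom hy) a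
    refine ⟨A, 𝟙 A, inferInstance,
      y ≫ ModuleCat.ofHom (h.pullDeform (by omega : k + 1 ≤ k + 2)), ?_,
      y ≫ ModuleCat.ofHom (h.pullLipHom (by omega : k ≤ k + 2)), ?_⟩
    · rw [csComplex_d]
      ext a
      exact h.csCobdry_pullDeform_eq_zero le_rfl (hy' a)
    · rw [cslipComplex_d, Category.id_comp]
      ext a
      exact (h.restrictCochain_pullDeform_succ (by omega) (hy' a)).symm

open CategoryTheory in
theorem LocalCones.isIso_homologyMap_restriction {C : ℝ≥0} (𝓒 : LocalCones X C) (k : ℕ) :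
    IsIso (HomologicalComplex.homologyMap (restriction X) k) := by
  obtain ⟨H, h₁, h₂, h₃⟩ := 𝓒.exists_deformation (k + 1)
  have h : IsLipDeformation H (k + 1) := ⟨h₁, h₂, h₃⟩
  have := h.mono_homologyMap
  have := h.epi_homologyMap
  exact isIso_of_mono_of_epi _

end Algebra

end LipCoho

namespace LipCoho

open Filter Topology Set Manifold Bundle

/-! ### Riemannian manifolds are locally conical -/

section Riemannian

universe u

variable {E : Type u} [NormedAddCommGroup E] [NormedSpace ℝ E] {H : Type*} [TopologicalSpace H]
  {I : ModelWithCorners ℝ E H} {M : Type*}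

/-- Up to a linear change of coordinates, the differential of a chart of a Riemannian manifold
distorts norms by a factor at most two near the base point of the chart. -/
theorem exists_almost_isometric_chart [TopologicalSpace M] [ChartedSpace H M]
    [IsManifold I 1 M] [I.Boundaryless]
    [RiemannianBundle (fun x : M => TangentSpace I x)]
    [IsContinuousRiemannianBundle E (fun x : M => TangentSpace I x)] (x : M) :
    ∃ (F : Type u) (_ : NormedAddCommGroup F) (_ : NormedSpace ℝ F) (e : E ≃L[ℝ] F),
      (∀ᶠ y in 𝓝 x, ∀ v : TangentSpace I y,
        ‖e (mfderiv I 𝓘(ℝ, E) (extChartAt I x) y v)‖ₑ ≤ 2 * ‖v‖ₑ) ∧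
      (∀ᶠ z in 𝓝 (extChartAt I x x), ∀ w : F,
        ‖(mfderivWithin 𝓘(ℝ, E) I (extChartAt I x).symm (range I) z (e.symm w) :
          TangentSpace I ((extChartAt I x).symm z))‖ₑ ≤ 2 * ‖w‖ₑ) := by
  have hx : x ∈ (trivializationAt E (TangentSpace I (M := M)) x).baseSet :=
    FiberBundle.mem_baseSet_trivializationAt' x
  have hsrc : (chartAt H x).source ∈ 𝓝 x := chart_source_mem_nhds H x
  have key : ∀ {a : ℝ} {b : ℝ}, 0 ≤ a → 0 ≤ b → a ≤ 2 * b →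
      ENNReal.ofReal a ≤ 2 * ENNReal.ofReal b := by
    intro a b _ _ hab
    refine (ENNReal.ofReal_le_ofReal hab).trans_eq ?_
    rw [ENNReal.ofReal_mul (by norm_num), ENNReal.ofReal_ofNat]
  -- The model space is renormed by the Riemannian norm at `x`; continuity of the metric then gives
  -- any distortion above 1 nearby, here 2.
  refine ⟨TangentSpace I x, inferInstance, inferInstance,
    ((trivializationAt E (TangentSpace I (M := M)) x).continuousLinearEquivAt ℝ x hx).symm, ?_, ?_⟩
  · filter_upwards [eventually_norm_symmL_trivializationAt_self_comp_lt E
      (fun x : M => TangentSpace I x) x one_lt_two, hsrc] with y hy hys v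
    rw [← ofReal_norm, ← ofReal_norm]
    refine key (norm_nonneg _) (norm_nonneg _) ?_
    rw [← TangentBundle.continuousLinearMapAt_trivializationAt hys]
    have h1 := ContinuousLinearMap.le_of_opNorm_le _ hy.le v
    rw [ContinuousLinearMap.comp_apply] at h1
    rw [Trivialization.symm_continuousLinearEquivAt_eq]
    exact h1
  · have hcont : Tendsto (extChartAt I x).symm (𝓝 (extChartAt I x x)) (𝓝 x) := by
      have := continuousAt_extChartAt_symm (I := I) x
      rwa [ContinuousAt, extChartAt_to_inv] at this
    filter_upwards [hcont.eventually (eventually_norm_symmL_trivializationAt_comp_self_lt E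
      (fun x : M => TangentSpace I x) x one_lt_two), hcont.eventually hsrc,
      extChartAt_target_mem_nhds x] with z hz hzs hzt w
    have hzz : extChartAt I x ((extChartAt I x).symm z) = z := (extChartAt I x).right_inv hzt
    rw [← ofReal_norm, ← ofReal_norm]
    refine key (norm_nonneg _) (norm_nonneg _) ?_
    have h1 := ContinuousLinearMap.le_of_opNorm_le _ hz.le w
    rw [ContinuousLinearMap.comp_apply] at h1
    have hA : ∀ v : E, (trivializationAt E (TangentSpace I (M := M)) x).symmL ℝ
        ((extChartAt I x).symm z) v =
        mfderivWithin 𝓘(ℝ, E) I (extChartAt I x).symm (range I) z v := by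
      intro v
      have h2 := congrArg (fun f : E →L[ℝ] E => f v) 
        (TangentBundle.symmL_trivializationAt (I := I) hzs)
      rw [hzz] at h2
      exact h2
    rw [hA] at h1
    rw [ContinuousLinearEquiv.symm_symm, Trivialization.coe_continuousLinearEquivAt_eq]
    exact h1

/-! ### Charts compared with the Riemannian distance -/

section Metric

variable [EMetricSpace M] [ChartedSpace H M] [IsManifold I 1 M]
  [RiemannianBundle (fun x : M => TangentSpace I x)]
  {F : Type*} [NormedAddCommGroup F] [NormedSpace ℝ F]

open MeasureTheory in
theorem edist_chart_le_two_mul_length (e : E ≃L[ℝ] F) {x : M} {γ : ℝ → M}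
    (hγ : ContMDiffOn 𝓘(ℝ, ℝ) I 1 γ (Icc 0 1)) {u : Set M}
    (hu : ∀ y ∈ u, y ∈ (chartAt H x).source ∧ ∀ v : TangentSpace I y,
      ‖e (mfderiv I 𝓘(ℝ, E) (extChartAt I x) y v)‖ₑ ≤ 2 * ‖v‖ₑ)
    (hγu : ∀ t ∈ Icc (0 : ℝ) 1, γ t ∈ u) :
    edist (e (extChartAt I x (γ 0))) (e (extChartAt I x (γ 1))) ≤ 2 * pathELength I γ 0 1 := by
  let γ' : ℝ → E := extChartAt I x ∘ γ
  have hγ' : ContMDiffOn 𝓘(ℝ, ℝ) 𝓘(ℝ, E) 1 γ' (Icc 0 1) :=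
    contMDiffOn_extChartAt.comp (t := (chartAt H x).source) hγ fun t ht => (hu _ (hγu t ht)).1
  have hγ'' : ContDiffOn ℝ 1 γ' (Icc 0 1) := contMDiffOn_iff_contDiffOn.1 hγ'
  have hc : ContDiffOn ℝ 1 (e ∘ γ') (Icc 0 1) := e.contDiff.comp_contDiffOn hγ''
  rw [edist_comm, edist_eq_enorm_sub]
  refine (enorm_sub_le_lintegral_derivWithin_Icc_of_contDiffOn_Icc hc zero_le_one).trans ?_
  rw [pathELength_eq_lintegral_mfderivWithin_Icc, ← lintegral_const_mul' _ _ (by simp)]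
  refine setLIntegral_mono' measurableSet_Icc fun t ht => ?_
  have hud := uniqueDiffOn_Icc (zero_lt_one (α := ℝ)) t ht
  have h1 : derivWithin (e ∘ γ') (Icc 0 1) t =
        e (mfderivWithin 𝓘(ℝ, ℝ) 𝓘(ℝ, E) γ' (Icc 0 1) t 1) := by
    rw [mfderivWithin_eq_fderivWithin, ← fderivWithin_derivWithin, e.comp_fderivWithin hud]
    rfl
  have h2 : mfderivWithin 𝓘(ℝ, ℝ) 𝓘(ℝ, E) γ' (Icc 0 1) t =
      (mfderiv I 𝓘(ℝ, E) (extChartAt I x) (γ t)).comp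
        (mfderivWithin 𝓘(ℝ, ℝ) I γ (Icc 0 1) t) := by
    refine mfderiv_comp_mfderivWithin t (mdifferentiableAt_extChartAt (hu _ (hγu t ht)).1)
      (hγ.mdifferentiableOn one_ne_zero t ht) ?_
    rwa [uniqueMDiffWithinAt_iff_uniqueDiffWithinAt]
  rw [h1, h2]
  exact (hu _ (hγu t ht)).2 _

/-- Nearly shortest curves between points close to `x` stay in the ball where the differential is
controlled, so the length estimate applies to them. -/
theorem exists_chart_lipschitz [IsRiemannianManifold I M] (e : E ≃L[ℝ] F) (x : M)
    (h : ∀ᶠ y in 𝓝 x, ∀ v : TangentSpace I y,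
      ‖e (mfderiv I 𝓘(ℝ, E) (extChartAt I x) y v)‖ₑ ≤ 2 * ‖v‖ₑ) :
    ∃ ρ > 0, ∀ y z : M, edist y x < ρ → edist z x < ρ →
      edist (e (extChartAt I x y)) (e (extChartAt I x z)) ≤ 2 * edist y z := by
  obtain ⟨ρ, hρ, hu⟩ := EMetric.mem_nhds_iff.1 (inter_mem (chart_source_mem_nhds H x) h)
  -- Points within `ρ / 4` of `x` are joined by curves shorter than `ρ / 2`, which stay within `3 *
  -- ρ / 4` of `x`.
  refine ⟨ρ / 2 / 2, ENNReal.half_pos (ENNReal.half_pos hρ.ne').ne', fun y z hy hz => ?_⟩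
  rw [mul_comm, ← ENNReal.div_le_iff (by simp) (by simp)]
  refine le_of_forall_gt_imp_ge_of_dense fun c hc => ?_
  have hyz : riemannianEDist I y z < min c (ρ / 2) := by
    rw [← IsRiemannianManifold.out (I := I)]
    refine lt_min hc ((edist_triangle_right y z x).trans_lt ?_)
    exact (ENNReal.add_lt_add hy hz).trans_eq (ENNReal.add_halves _)
  obtain ⟨γ, hγ0, hγ1, hγ, hlen⟩ := exists_lt_of_riemannianEDist_lt hyz
  rw [ENNReal.div_le_iff (by simp) (by simp), mul_comm]
  refine le_trans ?_ (mul_le_mul_right (hlen.le.trans (min_le_left _ _)) 2)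
  rw [← hγ0, ← hγ1]
  refine edist_chart_le_two_mul_length e hγ (u := Metric.eball x ρ) (fun w hw => hu hw)
    fun t ht => ?_
  have h1 : edist (γ 0) (γ t) ≤ pathELength I γ 0 1 := by
    rw [IsRiemannianManifold.out (I := I)]
    exact (riemannianEDist_le_pathELength (hγ.mono (Icc_subset_Icc le_rfl ht.2)) rfl rfl
      ht.1).trans (pathELength_mono le_rfl ht.2)
  rw [Metric.mem_eball]
  refine (edist_triangle_left _ _ (γ 0)).trans_lt ?_
  rw [← hγ0] at hy
  refine (ENNReal.add_lt_add (h1.trans_lt (hlen.trans_le (min_le_right _ _))) hy).trans_le ?_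
  refine (add_le_add_right ENNReal.half_le_self _).trans_eq (ENNReal.add_halves _)

open MeasureTheory in
-- The Riemannian distance is at most the length of the image of the straight segment.
theorem edist_chart_symm_le [IsRiemannianManifold I M] [I.Boundaryless] (e : E ≃L[ℝ] F)
    {x : M} {a b : F}
    (h : ∀ z ∈ segment ℝ (e.symm a) (e.symm b), z ∈ (extChartAt I x).target ∧ ∀ w : F,
        ‖(mfderivWithin 𝓘(ℝ, E) I (extChartAt I x).symm (range I) z (e.symm w) :
          TangentSpace I ((extChartAt I x).symm z))‖ₑ ≤ 2 * ‖w‖ₑ) :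
    edist ((extChartAt I x).symm (e.symm a)) ((extChartAt I x).symm (e.symm b)) ≤
      2 * edist a b := by
  let η : ℝ → E := fun t => e.symm a + t • (e.symm b - e.symm a)
  let γ : ℝ → M := (extChartAt I x).symm ∘ η
  have hη : ∀ t ∈ Icc (0 : ℝ) 1, η t ∈ segment ℝ (e.symm a) (e.symm b) := by
    intro t ht
    rw [segment_eq_image']
    exact ⟨t, ht, rfl⟩
  have hηs : ContMDiffOn 𝓘(ℝ, ℝ) 𝓘(ℝ, E) 1 η (Icc 0 1) := by
    rw [contMDiffOn_iff_contDiffOn]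
    exact ContDiff.contDiffOn (by fun_prop)
  have hmaps : MapsTo η (Icc 0 1) (extChartAt I x).target := fun t ht => (h _ (hη t ht)).1
  have h1 : edist ((extChartAt I x).symm (e.symm a)) ((extChartAt I x).symm (e.symm b)) ≤
      pathELength I γ 0 1 := by
    rw [IsRiemannianManifold.out (I := I)]
    refine riemannianEDist_le_pathELength ((contMDiffOn_extChartAt_symm x).comp hηs hmaps)
      ?_ ?_ zero_le_one
    · simp only [γ, η, Function.comp_apply, zero_smul, add_zero]
    · simp only [γ, η, Function.comp_apply, one_smul, add_sub_cancel]
  refine h1.trans ?_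
  rw [pathELength_eq_lintegral_mfderivWithin_Icc]
  have h2 : ∀ t ∈ Icc (0 : ℝ) 1,
      ‖mfderivWithin 𝓘(ℝ, ℝ) I γ (Icc 0 1) t 1‖ₑ ≤ 2 * edist a b := by
    intro t ht
    have h3 : mfderivWithin 𝓘(ℝ, ℝ) I γ (Icc 0 1) t =
        (mfderivWithin 𝓘(ℝ, E) I (extChartAt I x).symm (range I) (η t)).comp
          (mfderivWithin 𝓘(ℝ, ℝ) 𝓘(ℝ, E) η (Icc 0 1) t) := by
      apply mfderivWithin_comp
      · exact mdifferentiableWithinAt_extChartAt_symm (hmaps ht)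
      · exact hηs.mdifferentiableOn one_ne_zero t ht
      · exact fun s hs => extChartAt_target_subset_range x (hmaps hs)
      · rw [uniqueMDiffWithinAt_iff_uniqueDiffWithinAt]
        exact uniqueDiffOn_Icc zero_lt_one t ht
    have h4 : mfderivWithin 𝓘(ℝ, ℝ) 𝓘(ℝ, E) η (Icc 0 1) t 1 = e.symm (b - a) := by
      have hd : HasDerivAt η (e.symm b - e.symm a) t := by
        have := ((hasDerivAt_id t).smul_const (e.symm b - e.symm a)).const_add (e.symm a)
        rw [one_smul] at this
        exact this
      have hd' : derivWithin η (Icc 0 1) t = e.symm b - e.symm a :=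
        hd.hasDerivWithinAt.derivWithin (uniqueDiffOn_Icc zero_lt_one t ht)
      have hd'' := fderivWithin_derivWithin (𝕜 := ℝ) (f := η) (s := Icc 0 1) (x := t)
      rw [mfderivWithin_eq_fderivWithin, map_sub, ← hd']
      exact hd''
    rw [h3]
    refine le_of_eq_of_le ?_ (((h _ (hη t ht)).2 (b - a)).trans_eq ?_)
    · rw [← h4]
      rfl
    · rw [edist_comm, edist_eq_enorm_sub]
  refine (setLIntegral_mono' measurableSet_Icc h2).trans_eq ?_
  simp

/-- Near any point, a Riemannian manifold admits conical contractions to all points, with metric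
distortion four. -/
theorem exists_conical_nhd [IsRiemannianManifold I M] [I.Boundaryless]
    [IsContinuousRiemannianBundle E (fun x : M => TangentSpace I x)] (x : M) :
    ∃ ρ : ℝ≥0∞, 0 < ρ ∧ ∃ κ : M → ℝ → M → M, ∀ p, edist p x < ρ →
      IsConical 4 p {z | edist z x < ρ} (κ p) := by
  obtain ⟨F, _, _, e, h₁, h₂⟩ := exists_almost_isometric_chart (I := I) x
  obtain ⟨ρ₁, hρ₁, hφ⟩ := exists_chart_lipschitz e x h₁
  have htgt := extChartAt_target_mem_nhds (I := I) x
  have hc : ContinuousAt e.symm (e (extChartAt I x x)) := e.symm.continuous.continuousAt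
  rw [ContinuousAt, e.symm_apply_apply] at hc
  obtain ⟨R, hR, hball⟩ := EMetric.mem_nhds_iff.1 (hc (inter_mem htgt h₂))
  have hψ : ∀ a ∈ Metric.eball (e (extChartAt I x x)) R, ∀ b ∈ Metric.eball (e (extChartAt I x x)) R,
      edist ((extChartAt I x).symm (e.symm a)) ((extChartAt I x).symm (e.symm b)) ≤
        2 * edist a b := by
    intro a ha b hb
    refine edist_chart_symm_le e fun z hz => ?_
    have hz' : e z ∈ Metric.eball (e (extChartAt I x x)) R := by
      obtain ⟨c, d, hc, hd, hcd, rfl⟩ := hz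
      rw [map_add, map_smul, map_smul, e.apply_symm_apply, e.apply_symm_apply]
      exact convex_eball _ _ ha hb hc hd hcd
    have := hball hz'
    rw [mem_preimage, e.symm_apply_apply] at this
    exact this
  obtain ⟨ρ₂, hρ₂, hU⟩ := EMetric.mem_nhds_iff.1 (inter_mem (extChartAt_source_mem_nhds (I := I) x)
    ((e.continuous.continuousAt.comp (continuousAt_extChartAt (I := I) x)).preimage_mem_nhds
      (Metric.eball_mem_nhds _ hR)))
  let φ : M → F := fun y => e (extChartAt I x y)
  let ψ : F → M := fun a => (extChartAt I x).symm (e.symm a)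
  have hinv : ∀ y, edist y x < ρ₂ → ψ (φ y) = y := fun y hy => by
    simp only [φ, ψ, e.symm_apply_apply]
    exact (extChartAt I x).left_inv (hU hy).1
  have hmem : ∀ y, edist y x < ρ₂ → φ y ∈ Metric.eball (e (extChartAt I x x)) R := fun y hy =>
    (hU hy).2
  -- Straight-line contraction in the chart; the distortion 4 is 2 for `φ` times 2 for `ψ`. The cap
  -- 1 on the radius gives the bound 2 on distances to the centre.
  refine ⟨min ρ₁ (min ρ₂ 1), by positivity, fun p s z => ψ (φ p + s • (φ z - φ p)), fun p hp => ?_⟩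
  simp only [lt_min_iff] at hp ⊢
  refine ⟨fun z _ => ?_, fun z hz => ?_, fun z hz => ?_, fun s hs s' hs' z hz z' hz' => ?_⟩
  · rw [zero_smul, add_zero, hinv p hp.2.1]
  · rw [one_smul, add_sub_cancel, hinv z hz.2.1]
  · refine (edist_triangle_right p z x).trans ?_
    rw [← one_add_one_eq_two]
    exact add_le_add hp.2.2.le hz.2.2.le
  · have hconv := convex_eball (e (extChartAt I x x)) R
    refine (hψ _ (hconv.add_smul_sub_mem (hmem p hp.2.1) (hmem z hz.2.1) hs) _
      (hconv.add_smul_sub_mem (hmem p hp.2.1) (hmem z' hz'.2.1) hs')).trans ?_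
    have h3 : φ p + s • (φ z - φ p) - (φ p + s' • (φ z' - φ p)) =
        (s - s') • (φ z - φ p) + s' • (φ z - φ z') := by module
    rw [edist_eq_enorm_sub, h3]
    have h4 : ‖(s - s') • (φ z - φ p)‖ₑ ≤ ENNReal.ofReal |s - s'| * (2 * edist p z) := by
      rw [enorm_smul, Real.enorm_eq_ofReal_abs, ← edist_eq_enorm_sub, edist_comm p z]
      exact mul_le_mul_right (hφ z p hz.1 hp.1) _
    have h5 : ‖s' • (φ z - φ z')‖ₑ ≤ ENNReal.ofReal s' * (2 * edist z z') := by
      rw [enorm_smul, Real.enorm_eq_ofReal_abs, abs_of_nonneg hs'.1, ← edist_eq_enorm_sub]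
      exact mul_le_mul_right (hφ z z' hz.1 hz'.1) _
    refine (mul_le_mul_right ((enorm_add_le _ _).trans (add_le_add h4 h5)) 2).trans_eq ?_
    push_cast
    ring

/-- A Riemannian manifold of finite dimension carries a local conical structure. -/
theorem nonempty_localCones [IsRiemannianManifold I M] [I.Boundaryless] [LocallyCompactSpace M]
    [IsContinuousRiemannianBundle E (fun x : M => TangentSpace I x)] :
    Nonempty (LocalCones M 4) := by
  let Good : M → ℝ≥0∞ → Prop := fun x ρ =>
    (∃ κ : M → ℝ → M → M, ∀ p, edist p x < ρ → IsConical 4 p {z | edist z x < ρ} (κ p)) ∧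
    ∃ K, IsCompact K ∧ {z | edist z x < ρ} ⊆ K
  have hmono : ∀ x y ρ ρ', Good x ρ → (∀ z, edist z y < ρ' → edist z x < ρ) → Good y ρ' := by
    rintro x y ρ ρ' ⟨⟨κ, hκ⟩, K, hK, hKs⟩ h
    exact ⟨⟨κ, fun p hp => (hκ p (h p hp)).mono h⟩, K, hK, fun z hz => hKs (h z hz)⟩
  have hex : ∀ x, ∃ ρ, 0 < ρ ∧ ρ ≤ 1 ∧ Good x ρ := by
    intro x
    obtain ⟨ρ₁, hρ₁, κ, hκ⟩ := exists_conical_nhd (I := I) x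
    obtain ⟨K, hK, hKx⟩ := exists_compact_mem_nhds x
    obtain ⟨ρ₂, hρ₂, hKs⟩ := EMetric.mem_nhds_iff.1 hKx
    refine ⟨min (min ρ₁ ρ₂) 1, by positivity, min_le_right _ _, ⟨κ, fun p hp => ?_⟩, K, hK,
      fun z hz => hKs ?_⟩
    · simp only [lt_min_iff] at hp
      refine (hκ p hp.1.1).mono fun z hz => ?_
      have hz' : edist z x < min (min ρ₁ ρ₂) 1 := hz
      exact hz'.trans_le ((min_le_left _ _).trans (min_le_left _ _))
    · have hz' : edist z x < min (min ρ₁ ρ₂) 1 := hz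
      exact hz'.trans_le ((min_le_left _ _).trans (min_le_right _ _))
  -- A good ball about `x` contains the ball about `y` whose radius is smaller by `edist x y`, and
  -- goodness passes to it. So this supremum is automatically 1-Lipschitz.
  let R : M → ℝ≥0∞ := fun x => sSup {ρ | ρ ≤ 1 ∧ Good x ρ}
  have hR1 : ∀ x, R x ≤ 1 := fun x => sSup_le fun ρ hρ => hρ.1
  have hR0 : ∀ x, 0 < R x := fun x => by
    obtain ⟨ρ, h0, h1, hG⟩ := hex x
    exact h0.trans_le (le_sSup ⟨h1, hG⟩)
  have hRG : ∀ x, ∃ ρ, R x / 2 < ρ ∧ Good x ρ := fun x => by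
    obtain ⟨ρ, hρ, hlt⟩ := lt_sSup_iff.1
      (ENNReal.half_lt_self (hR0 x).ne' ((hR1 x).trans_lt ENNReal.one_lt_top).ne)
    exact ⟨ρ, hlt, hρ.2⟩
  choose ρ hρ hG using hRG
  choose κ hκ using fun x => (hG x).1
  -- The supremum need not be attained. Halving puts the closed ball inside an open good ball and
  -- keeps the scale 1-Lipschitz.
  refine ⟨fun x => R x / 2, fun x => κ x x, fun x => ENNReal.half_pos (hR0 x).ne',
    fun x => ENNReal.half_le_self.trans (hR1 x), fun x y => ?_, fun x => ?_, fun x => ?_⟩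
  · have h : R x ≤ R y + edist x y := by
      refine sSup_le fun r hr => ?_
      rw [← tsub_le_iff_right]
      refine le_sSup ⟨tsub_le_self.trans hr.1, hmono x y r _ hr.2 fun z hz => ?_⟩
      refine (edist_triangle z y x).trans_lt ?_
      rw [edist_comm y x]
      exact lt_tsub_iff_right.1 hz
    calc R x / 2 ≤ (R y + edist x y) / 2 := ENNReal.div_le_div_right h 2
      _ = R y / 2 + edist x y / 2 := ENNReal.add_div
      _ ≤ R y / 2 + edist x y := add_le_add_right ENNReal.half_le_self _
  · refine (hκ x x ?_).mono fun z hz => lt_of_le_of_lt hz (hρ x)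
    rw [edist_self]
    exact bot_le.trans_lt (hρ x)
  · obtain ⟨K, hK, hKs⟩ := (hG x).2
    exact ⟨K, hK, fun z hz => hKs (lt_of_le_of_lt hz (hρ x))⟩

end Metric

end Riemannian

end LipCoho

end

/-! ### The theorem for smooth Riemannian manifolds -/

theorem theorem3p7 {n : ℕ} {M : Type*} [EMetricSpace M] [ConnectedSpace M]
    [ChartedSpace (EuclideanSpace ℝ (Fin n)) M] [IsManifold (𝓡 n) ∞ M]
    [Bundle.RiemannianBundle (fun x : M => TangentSpace (𝓡 n) x)]
    [IsContMDiffRiemannianBundle (𝓡 n) ∞ (EuclideanSpace ℝ (Fin n))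
      (fun x : M => TangentSpace (𝓡 n) x)]
    [IsRiemannianManifold (𝓡 n) M] :
    ∀ k : ℕ, CategoryTheory.IsIso
      (HomologicalComplex.homologyMap (LipCoho.restriction M) k) := by
  intro k
  have : IsContinuousRiemannianBundle (EuclideanSpace ℝ (Fin n))
      (fun x : M => TangentSpace (𝓡 n) x) := by
    obtain ⟨g, hg, hgi⟩ := IsContMDiffRiemannianBundle.exists_contMDiff (IB := 𝓡 n) (n := ∞)
      (F := EuclideanSpace ℝ (Fin n)) (E := fun x : M => TangentSpace (𝓡 n) x)
    exact ⟨g, hg.continuous, hgi⟩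
  have : LocallyCompactSpace M := ChartedSpace.locallyCompactSpace (EuclideanSpace ℝ (Fin n)) M
  obtain ⟨𝓒⟩ := LipCoho.nonempty_localCones (I := 𝓡 n) (M := M)
  exact 𝓒.isIso_homologyMap_restriction k
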